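/- Let $d\ge 1$, $\hat f(\eta)=\int_{\mathbb R^d} f(x)e^{-2\pi i x\cdot\eta}\,dx$, and let $g\in\mathcal S(\mathbb R^n)\setminus\{0\}$ be any window. For $u\in\mathcal S'(\mathbb R^n)$ put $V_gu(x,\omega)=\langle u, e^{2\pi i\,\omega\cdot(\,\cdot\,)}g(\cdot-x)\rangle$ (pairing conjugate linear in the second argument). For $1\le p,q\le\infty$ let $$\|u\|_{M^{p,q}}=\Big\|\,\omega\mapsto\|V_gu(\cdot,\omega)\|_{L^p(\mathbb R^n)}\Big\|_{L^q(\mathbb R^n)},$$ let $M^{p,q}(\mathbb R^n)$ be the set of $u\in\mathcal S'(\mathbb R^n)$ with $\|u\|_{M^{p,q}}<\infty$, and let $\mathcal M^{p,q}(\mathbb R^n)$ be the closure of $\mathcal S(\mathbb R^n)$ in $M^{p,q}(\mathbb R^n)$. An operator $T$ on $\mathcal S(\mathbb R^d)$ is called bounded from $\mathcal M^{r_1,r_2}(\mathbb R^d)$ to $\mathcal M^{t_1,t_2}(\mathbb R^d)$ if it extends to a bounded linear operator between these spaces. A function $\Phi\in C^\infty(\mathbb R^{2d};\mathbb R)$ is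 called tame if all its partial derivatives of order at least $2$ are bounded and $\inf_{(x,\eta)}\big|\det\big(\partial^2\Phi/\partial x_i\partial\eta_l\big)\big|>0$. **Proposition.** (a) For $1\le r_1,r_2,t_1,t_2\le\infty$ the Schrödinger multiplier $$Tf(x)=\int_{\mathbb R^d}e^{2\pi i x\cdot\eta}\,e^{\pi i|\eta|^2}\,\hat f(\eta)\,d\eta,\qquad f\in\mathcal S(\mathbb R^d),$$ is bounded from $\mathcal M^{r_1,r_2}(\mathbb R^d)$ to $\mathcal M^{t_1,t_2}(\mathbb R^d)$ if and only if $r_1\le t_1$ and $r_2\le t_2$. (b) $T$ is the Fourier integral operator $T_{\Phi,\sigma}f(x)=\int_{\mathbb R^d} e^{2\pi i\Phi(x,\eta)}\sigma(x,\eta)\hat f(\eta)\,d\eta$ with phase $\Phi(x,\eta)=x\cdot\eta+|\eta|^2/2$ and symbol $\sigma\equiv1$; this phase is tame and satisfies $$\Big|\det\Big(\frac{\partial^2\Phi}{\partial\eta_i\partial\eta_l}\Big|_{(x,\eta)}\Big)\Big|\ge\delta\quad\text{for all }(x,\eta)\in\mathbb R^{2d},\text{ for some }\delta>0,\qquad(*)$$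 and $\sigma\equiv1$ belongs to $M^{\infty,1}(\mathbb R^{2d})$. Consequently, for every $1\le r_1<r_2\le\infty$ the following conjecture is false: for every tame $\Phi$ satisfying $(*)$ and every $\sigma\in M^{\infty,1}(\mathbb R^{2d})$, the operator $T_{\Phi,\sigma}$ is bounded from $\mathcal M^{r_1,r_2}(\mathbb R^d)$ to $\mathcal M^{r_2,r_1}(\mathbb R^d)$. -/

import Mathlib

open MeasureTheory SchwartzMap
open scoped ENNReal NNReal FourierTransform RealInnerProductSpace

noncomputable section ModulationSpaces

variable {V : Type*} [NormedAddCommGroup V] [InnerProductSpace ℝ V] [FiniteDimensional ℝ V]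
  [MeasurableSpace V] [BorelSpace V]

/-- The character `y ↦ e^{2πi y·ω}`. -/
def modChar {W : Type*} [NormedAddCommGroup W] [InnerProductSpace ℝ W] (ω : W) (y : W) : ℂ :=
  Complex.exp (2 * Real.pi * Complex.I * ((⟪y, ω⟫ : ℝ) : ℂ))

theorem modChar_hasTemperateGrowth {W : Type*} [NormedAddCommGroup W] [InnerProductSpace ℝ W]
    (ω : W) : Function.HasTemperateGrowth (modChar ω) := by
  have hd : ∀ n : ℕ, iteratedDeriv n (fun t : ℝ => Complex.exp (2 * Real.pi * Complex.I * t)) =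
      fun t : ℝ => (2 * Real.pi * Complex.I) ^ n * Complex.exp (2 * Real.pi * Complex.I * t) := by
    intro n
    induction n with
    | zero => simp
    | succ n ih =>
      rw [iteratedDeriv_succ, ih]
      funext t
      have h1 : HasDerivAt (fun t : ℝ => 2 * Real.pi * Complex.I * (t : ℂ))
          (2 * Real.pi * Complex.I) t := by
        simpa using (Complex.ofRealCLM.hasDerivAt (x := t)).const_mul (2 * Real.pi * Complex.I)
      rw [(h1.cexp.const_mul ((2 * Real.pi * Complex.I) ^ n)).deriv]
      ring
  have hexp : Function.HasTemperateGrowth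
      (fun t : ℝ => Complex.exp (2 * Real.pi * Complex.I * t)) := by
    refine ⟨(contDiff_const.mul Complex.ofRealCLM.contDiff).cexp,
      fun n => ⟨0, (2 * Real.pi) ^ n, fun t => ?_⟩⟩
    rw [norm_iteratedFDeriv_eq_norm_iteratedDeriv, hd]
    have h2 : ‖Complex.exp (2 * Real.pi * Complex.I * t)‖ = 1 := by
      rw [Complex.norm_exp]
      simp
    simp [h2, abs_of_pos Real.pi_pos]
  exact hexp.comp (Function.hasTemperateGrowth_inner_left ω)

/-- The time-frequency shift `M_ω T_x g`, that is `y ↦ e^{2πi y·ω} g(y - x)`. -/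
def tfShift {W : Type*} [NormedAddCommGroup W] [InnerProductSpace ℝ W]
    (x ω : W) (g : 𝓢(W, ℂ)) : 𝓢(W, ℂ) :=
  SchwartzMap.smulLeftCLM ℂ (modChar ω) (g.compSubConstCLM ℂ x)

theorem tfShift_apply {W : Type*} [NormedAddCommGroup W] [InnerProductSpace ℝ W]
    (x ω : W) (g : 𝓢(W, ℂ)) (y : W) :
    tfShift x ω g y = modChar ω y * g (y - x) := by
  rw [tfShift, SchwartzMap.smulLeftCLM_apply_apply (modChar_hasTemperateGrowth ω)]
  rfl

/-- Complex conjugation of a Schwartz function. -/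
def schwartzConj {W : Type*} [NormedAddCommGroup W] [NormedSpace ℝ W] (g : 𝓢(W, ℂ)) : 𝓢(W, ℂ) :=
  SchwartzMap.postcompCLM (𝕜 := ℝ) (Complex.conjCLE : ℂ →L[ℝ] ℂ) g

theorem schwartzConj_apply {W : Type*} [NormedAddCommGroup W] [NormedSpace ℝ W]
    (g : 𝓢(W, ℂ)) (y : W) :
    schwartzConj g y = (starRingEnd ℂ) (g y) := rfl

/-- The short-time Fourier transform `V_g u (x, ω) = ⟨u, M_ω T_x g⟩` of a tempered distribution
`u` with window `g`; the pairing `⟨·, ·⟩` is conjugate linear in the second argument. -/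
def stft (g : 𝓢(V, ℂ)) (u : 𝓢'(V, ℂ)) (x ω : V) : ℂ :=
  u (schwartzConj (tfShift x ω g))

/-- For Schwartz functions the short-time Fourier transform is the usual integral. -/
theorem stft_schwartz (g f : 𝓢(V, ℂ)) (x ω : V) :
    stft g (f : 𝓢'(V, ℂ)) x ω =
      ∫ y, (starRingEnd ℂ) (modChar ω y) * f y * (starRingEnd ℂ) (g (y - x)) := by
  rw [stft, SchwartzMap.coe_apply]
  refine integral_congr_ae (Filter.Eventually.of_forall fun y => ?_)
  simp only [schwartzConj_apply, tfShift_apply, map_mul, smul_eq_mul]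
  ring

/-- The modulation space norm `‖u‖_{M^{p,q}}`, the mixed `L^{p,q}` norm of `V_g u`
(`L^p` in the position variable inside, `L^q` in the frequency variable outside). -/
def modNorm (g : 𝓢(V, ℂ)) (p q : ℝ≥0∞) (u : 𝓢'(V, ℂ)) : ℝ≥0∞ :=
  eLpNorm (fun ω : V => eLpNorm (fun x : V => stft g u x ω) p volume) q volume

/-- The modulation space `M^{p,q}`. -/
def modSpace (g : 𝓢(V, ℂ)) (p q : ℝ≥0∞) : Set 𝓢'(V, ℂ) :=
  {u | modNorm g p q u < ∞}

/-- The closure `𝓜^{p,q}` of the Schwartz space in the norm of `M^{p,q}`. -/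
def modSpaceClosure (g : 𝓢(V, ℂ)) (p q : ℝ≥0∞) : Set 𝓢'(V, ℂ) :=
  {u | u ∈ modSpace g p q ∧
    ∀ ε : ℝ≥0∞, 0 < ε → ∃ f : 𝓢(V, ℂ), modNorm g p q (u - (f : 𝓢'(V, ℂ))) < ε}

/-- The tempered distribution `u` is given by integration against the function `h`. -/
def IsGivenBy (u : 𝓢'(V, ℂ)) (h : V → ℂ) : Prop :=
  ∀ φ : 𝓢(V, ℂ), Integrable (fun x => φ x * h x) ∧ u φ = ∫ x, φ x * h x

/-- An operator `T`, defined on Schwartz functions and with values in functions, is bounded from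
`𝓜^{r₁,r₂}` to `𝓜^{t₁,t₂}`: there is a linear operator with domain `𝓜^{r₁,r₂}` and values in
`𝓜^{t₁,t₂}`, bounded for the respective norms, that agrees with `T` on Schwartz functions. -/
def IsBoundedOnMod (g : 𝓢(V, ℂ)) (r₁ r₂ t₁ t₂ : ℝ≥0∞) (T : 𝓢(V, ℂ) → V → ℂ) : Prop :=
  ∃ A : 𝓢'(V, ℂ) →ₗ.[ℂ] 𝓢'(V, ℂ),
    (A.domain : Set 𝓢'(V, ℂ)) = modSpaceClosure g r₁ r₂ ∧
    (∀ (f : 𝓢(V, ℂ)) (hf : (f : 𝓢'(V, ℂ)) ∈ A.domain), IsGivenBy (A ⟨f, hf⟩) (T f)) ∧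
    (∀ u : A.domain, A u ∈ modSpaceClosure g t₁ t₂) ∧
    ∃ C : ℝ≥0, ∀ u : A.domain, modNorm g t₁ t₂ (A u) ≤ C * modNorm g r₁ r₂ (u : 𝓢'(V, ℂ))

/-- The Schrödinger multiplier `T f(x) = ∫ e^{2πi x·η} e^{πi|η|²} f̂(η) dη`. -/
def schrodingerMultiplier (f : 𝓢(V, ℂ)) (x : V) : ℂ :=
  ∫ η : V, Complex.exp (2 * Real.pi * Complex.I * ((⟪x, η⟫ : ℝ) : ℂ)) *
    Complex.exp (Real.pi * Complex.I * ((‖η‖ ^ 2 : ℝ) : ℂ)) * 𝓕 f η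

/-- The Fourier integral operator `T f(x) = ∫ e^{2πi Φ(x,η)} σ(x,η) f̂(η) dη`. -/
def fourierIntegralOperator (Φ : WithLp 2 (V × V) → ℝ) (σ : WithLp 2 (V × V) → ℂ)
    (f : 𝓢(V, ℂ)) (x : V) : ℂ :=
  ∫ η : V, Complex.exp (2 * Real.pi * Complex.I * ((Φ (WithLp.toLp 2 (x, η)) : ℝ) : ℂ)) *
    σ (WithLp.toLp 2 (x, η)) * 𝓕 f η

/-- `σ` is a symbol in Sjöstrand's class `M^{∞,1}`, whose elements are continuous functions
(`G` is a window on the phase space). -/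
def IsSjostrandSymbol (G : 𝓢(WithLp 2 (V × V), ℂ)) (σ : WithLp 2 (V × V) → ℂ) : Prop :=
  Continuous σ ∧ ∃ s ∈ modSpace G ∞ 1, IsGivenBy s σ

end ModulationSpaces

noncomputable section Phases

variable {d : ℕ}

/-- The basis vector of the phase space in the direction `x_i`. -/
def basisX (i : Fin d) :
    WithLp 2 (EuclideanSpace ℝ (Fin d) × EuclideanSpace ℝ (Fin d)) :=
  WithLp.toLp 2 (EuclideanSpace.single i 1, 0)

/-- The basis vector of the phase space in the direction `η_i`. -/
def basisEta (i : Fin d) :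
    WithLp 2 (EuclideanSpace ℝ (Fin d) × EuclideanSpace ℝ (Fin d)) :=
  WithLp.toLp 2 (0, EuclideanSpace.single i 1)

/-- The matrix `(∂²Φ / ∂x_i ∂η_l)`. -/
def mixedHessian
    (Φ : WithLp 2 (EuclideanSpace ℝ (Fin d) × EuclideanSpace ℝ (Fin d)) → ℝ)
    (z : WithLp 2 (EuclideanSpace ℝ (Fin d) × EuclideanSpace ℝ (Fin d))) :
    Matrix (Fin d) (Fin d) ℝ :=
  Matrix.of fun i l => iteratedFDeriv ℝ 2 Φ z ![basisX i, basisEta l]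

/-- The matrix `(∂²Φ / ∂η_i ∂η_l)`. -/
def etaHessian
    (Φ : WithLp 2 (EuclideanSpace ℝ (Fin d) × EuclideanSpace ℝ (Fin d)) → ℝ)
    (z : WithLp 2 (EuclideanSpace ℝ (Fin d) × EuclideanSpace ℝ (Fin d))) :
    Matrix (Fin d) (Fin d) ℝ :=
  Matrix.of fun i l => iteratedFDeriv ℝ 2 Φ z ![basisEta i, basisEta l]

/-- Tame phase functions: smooth, with bounded derivatives of every order at least two, and with
uniformly non-degenerate mixed Hessian. -/
structure IsTamePhase
    (Φ : WithLp 2 (EuclideanSpace ℝ (Fin d) × EuclideanSpace ℝ (Fin d)) → ℝ) : Prop where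
  smooth : ContDiff ℝ ((⊤ : ℕ∞) : WithTop ℕ∞) Φ
  bounded_deriv : ∀ n : ℕ, 2 ≤ n → ∃ C : ℝ, ∀ z, ‖iteratedFDeriv ℝ n Φ z‖ ≤ C
  nondegenerate : ∃ δ : ℝ, 0 < δ ∧ ∀ z, δ ≤ |(mixedHessian Φ z).det|

/-- The condition `|det (∂²Φ / ∂η_i ∂η_l)| ≥ δ` on the whole phase space, for some `δ > 0`. -/
def IsEtaNondegenerate
    (Φ : WithLp 2 (EuclideanSpace ℝ (Fin d) × EuclideanSpace ℝ (Fin d)) → ℝ) : Prop :=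
  ∃ δ : ℝ, 0 < δ ∧ ∀ z, δ ≤ |(etaHessian Φ z).det|

/-- The phase `x·η + |η|²/2`. -/
def schrodingerPhase
    (z : WithLp 2 (EuclideanSpace ℝ (Fin d) × EuclideanSpace ℝ (Fin d))) : ℝ :=
  ⟪z.fst, z.snd⟫ + ‖z.snd‖ ^ 2 / 2

end Phases

/-! In the time-frequency plane the Schrödinger multiplier is a shear: `V_g(Tu)(x, ω)` is a
unimodular factor times `V_γ u(x + ω, ω)`, where γ = `chirpWindow g` is nonzero
(`stft_fourierMultiplier_chirp`). For fixed ω this is a translation in x, which the inner `L^p` norm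
does not see. Hence the `M^{p,q}` norm of `Tu` with window g is exactly that of `u` with window γ,
and boundedness of T amounts to an embedding of `M^{r₁,r₂}` into `M^{t₁,t₂}` on Schwartz functions,
up to a change of window.

The embedding for increasing exponents and the independence of the window come from one estimate,
`exists_modNorm_le`. The reproducing formula `stft_eq_integral` bounds `|V_f u|` by the convolution
of `|V_g u|` with a bounded integrable kernel, and a mixed-norm Young inequality shows that such
convolutions map `L^{r₁,r₂}` to `L^{t₁,t₂}` whenever the exponents do not decrease. The reproducing
formula for distributions rests on exchanging `u` with an integral of Schwartz functions
(`TemperedDistribution.apply_eq_integral`).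

Conversely, take φ compactly supported, also as window. The sum of N far-apart translates of φ has
norm `N^{1/p}` times that of φ, since the transforms have disjoint supports in x. For φ with
compactly supported Fourier transform, N far-apart modulations give `N^{1/q}`. Letting N grow forces
`r₁ ≤ t₁` and `r₂ ≤ t₂`.

For the conjecture, the phase is quadratic with both Hessian blocks equal to the identity, and `|V_G
1(x, ω)| = |𝓕⁻ G(ω)|` is bounded in x and integrable in ω. So T is an admissible operator, yet
boundedness with `(t₁, t₂) = (r₂, r₁)` would give `r₂ ≤ r₁`. -/

/-! ### Exchanging tempered distributions with integrals of Schwartz functions. -/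

section WeakIntegral

open LineDeriv

variable {V : Type*} [NormedAddCommGroup V] [NormedSpace ℝ V]
  {W : Type*} [TopologicalSpace W] [SecondCountableTopology W] [MeasurableSpace W] [BorelSpace W]
  {μ : Measure W}

/-- A continuous family of Schwartz functions all of whose seminorms are integrable. -/
structure IsSchwartzIntegrable (μ : Measure W) (F : W → 𝓢(V, ℂ)) : Prop where
  continuous : Continuous F
  integrable : ∀ k n, Integrable (fun w => SchwartzMap.seminorm ℂ k n (F w)) μ

theorem SchwartzMap.exists_seminorm_clm_le (L : 𝓢(V, ℂ) →L[ℂ] 𝓢(V, ℂ)) (k n : ℕ) :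
    ∃ (s : Finset (ℕ × ℕ)) (C : ℝ), 0 ≤ C ∧ ∀ f : 𝓢(V, ℂ),
      SchwartzMap.seminorm ℂ k n (L f) ≤ C * ∑ i ∈ s, SchwartzMap.seminorm ℂ i.1 i.2 f := by
  obtain ⟨s, C, -, h⟩ := Seminorm.bound_of_continuous (schwartz_withSeminorms ℂ V ℂ)
    ((SchwartzMap.seminorm ℂ k n).comp (L : 𝓢(V, ℂ) →ₗ[ℂ] 𝓢(V, ℂ)))
    (by exact ((schwartz_withSeminorms ℂ V ℂ).continuous_seminorm (k, n)).comp L.continuous)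
  refine ⟨s, C, C.2, fun f => (h f).trans ?_⟩
  have h1 := Seminorm.finset_sup_le_sum (schwartzSeminormFamily ℂ V ℂ) s f
  simp only [FunLike.coe_sum, Finset.sum_apply] at h1
  exact mul_le_mul_of_nonneg_left h1 C.2

namespace IsSchwartzIntegrable

variable {F : W → 𝓢(V, ℂ)}

theorem clm_comp (hF : IsSchwartzIntegrable μ F) (L : 𝓢(V, ℂ) →L[ℂ] 𝓢(V, ℂ)) :
    IsSchwartzIntegrable μ (fun w => L (F w)) := by
  refine ⟨L.continuous.comp hF.continuous, fun k n => ?_⟩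
  obtain ⟨s, C, hC, h⟩ := SchwartzMap.exists_seminorm_clm_le L k n
  refine Integrable.mono' ((integrable_finsetSum s fun i _ => hF.integrable i.1 i.2).const_mul C)
    (((schwartz_withSeminorms ℂ V ℂ).continuous_seminorm (k, n)).comp
      (L.continuous.comp hF.continuous)).aestronglyMeasurable
    (Filter.Eventually.of_forall fun w => ?_)
  rw [Real.norm_of_nonneg (apply_nonneg _ _)]
  exact h (F w)

theorem continuous_apply (hF : IsSchwartzIntegrable μ F) (y : V) :
    Continuous fun w => F w y := by
  have h : Continuous fun f : 𝓢(V, ℂ) => f y :=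
    (BoundedContinuousFunction.evalCLM ℂ y).continuous.comp
      (SchwartzMap.toBoundedContinuousFunctionCLM ℂ V ℂ).continuous
  exact h.comp hF.continuous

theorem integrable_apply (hF : IsSchwartzIntegrable μ F) (y : V) :
    Integrable (fun w => F w y) μ :=
  (hF.integrable 0 0).mono' (hF.continuous_apply y).aestronglyMeasurable
    (Filter.Eventually.of_forall fun w => SchwartzMap.norm_le_seminorm ℂ (F w) y)

/-- Differentiation under the integral sign along the line `y + t • m`. The seminorm of index (0, 1)
dominates uniformly in `t`, so the domination holds on the whole line. -/
theorem lineDerivOp_eq_integral (hF : IsSchwartzIntegrable μ F) {φ : 𝓢(V, ℂ)}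
    (hφ : ∀ y, φ y = ∫ w, F w y ∂μ) (m y : V) :
    ∂_{m} φ y = ∫ w, ∂_{m} (F w) y ∂μ := by
  have hd : ∀ (f : 𝓢(V, ℂ)) (t : ℝ),
      HasDerivAt (fun t : ℝ => f (y + t • m)) (fderiv ℝ f (y + t • m) m) t := by
    intro f t
    have h1 : HasDerivAt (fun t : ℝ => y + t • m) m t := by
      simpa using ((hasDerivAt_id t).smul_const m).const_add y
    exact (f.hasFDerivAt (y + t • m)).comp_hasDerivAt t h1
  have hG : IsSchwartzIntegrable μ (fun w => ∂_{m} (F w)) :=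
    hF.clm_comp (lineDerivOpCLM ℂ 𝓢(V, ℂ) m)
  have key := (hasDerivAt_integral_of_dominated_loc_of_deriv_le (μ := μ) (𝕜 := ℝ) (x₀ := 0)
    (F := fun t w => F w (y + t • m)) (F' := fun t w => fderiv ℝ (F w) (y + t • m) m)
    (bound := fun w => SchwartzMap.seminorm ℂ 0 1 (F w) * ‖m‖) Filter.univ_mem
    (Filter.Eventually.of_forall fun t => (hF.continuous_apply _).aestronglyMeasurable)
    (by simpa using hF.integrable_apply y)
    (by simpa [SchwartzMap.lineDerivOp_apply_eq_fderiv] using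
      (hG.continuous_apply y).aestronglyMeasurable)
    (Filter.Eventually.of_forall fun w t _ => ?_)
    ((hF.integrable 0 1).mul_const _)
    (Filter.Eventually.of_forall fun w t _ => hd (F w) t)).2
  · have h0 := hd φ 0
    simp only [hφ] at h0
    rw [SchwartzMap.lineDerivOp_apply_eq_fderiv]
    have := h0.unique key
    simp only [zero_smul, add_zero] at this
    rw [this]
    rfl
  · refine (ContinuousLinearMap.le_opNorm _ _).trans ?_
    gcongr
    rw [← norm_iteratedFDeriv_one]
    exact SchwartzMap.norm_iteratedFDeriv_le_seminorm ℂ (F w) 1 _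

theorem iteratedLineDerivOp_eq_integral (n : ℕ) (m : Fin n → V) :
    ∀ {F : W → 𝓢(V, ℂ)}, IsSchwartzIntegrable μ F → ∀ {φ : 𝓢(V, ℂ)},
      (∀ y, φ y = ∫ w, F w y ∂μ) →
      IsSchwartzIntegrable μ (fun w => ∂^{m} (F w)) ∧
        ∀ y, ∂^{m} φ y = ∫ w, ∂^{m} (F w) y ∂μ := by
  induction n with
  | zero => intro F hF φ hφ; exact ⟨by simpa using hF, by simpa using hφ⟩
  | succ n ih =>
    intro F hF φ hφ
    obtain ⟨h1, h2⟩ := ih (Fin.tail m) hF hφ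
    refine ⟨?_, fun y => ?_⟩
    · simp only [iteratedLineDerivOp_succ_left]
      exact h1.clm_comp (lineDerivOpCLM ℂ 𝓢(V, ℂ) (m 0))
    · simp only [iteratedLineDerivOp_succ_left]
      exact h1.lineDerivOp_eq_integral h2 (m 0) y

end IsSchwartzIntegrable

namespace SchwartzMap

/-- Bounded continuous functions with values in the `n`-linear forms. -/
def BoundedForms (V : Type*) [NormedAddCommGroup V] [NormedSpace ℝ V] (n : ℕ) : Type _ :=
  BoundedContinuousFunction V (V [×n]→L[ℝ] ℂ)

noncomputable instance (n : ℕ) : NormedAddCommGroup (BoundedForms V n) :=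
  inferInstanceAs (NormedAddCommGroup (BoundedContinuousFunction V (V [×n]→L[ℝ] ℂ)))

noncomputable instance (n : ℕ) : NormedSpace ℂ (BoundedForms V n) :=
  inferInstanceAs (NormedSpace ℂ (BoundedContinuousFunction V (V [×n]→L[ℝ] ℂ)))

instance (n : ℕ) : CompleteSpace (BoundedForms V n) :=
  inferInstanceAs (CompleteSpace (BoundedContinuousFunction V (V [×n]→L[ℝ] ℂ)))

/-- Evaluation of a bounded form at a point and a tuple of vectors. -/
noncomputable def BoundedForms.eval {n : ℕ} (y : V) (m : Fin n → V) :
    BoundedForms V n →L[ℂ] ℂ :=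
  LinearMap.mkContinuous
    { toFun := fun f => (show BoundedContinuousFunction V (V [×n]→L[ℝ] ℂ) from f) y m
      map_add' := fun _ _ => rfl
      map_smul' := fun _ _ => rfl } (∏ i, ‖m i‖) (fun f => by
        rw [mul_comm]
        exact (ContinuousMultilinearMap.le_opNorm _ m).trans (mul_le_mul_of_nonneg_right
          ((show BoundedContinuousFunction V (V [×n]→L[ℝ] ℂ) from f).norm_coe_le_norm y)
          (Finset.prod_nonneg fun i _ => norm_nonneg _)))

theorem BoundedForms.ext_eval {n : ℕ} {f g : BoundedForms V n}
    (h : ∀ y m, BoundedForms.eval y m f = BoundedForms.eval y m g) : f = g :=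
  BoundedContinuousFunction.ext fun y => ContinuousMultilinearMap.ext fun m => h y m

/-- The bounded continuous function `y ↦ ‖y‖ ^ k • D^n f (y)`. -/
noncomputable def weightedIteratedFDeriv (k n : ℕ) :
    𝓢(V, ℂ) →ₗ[ℂ] BoundedForms V n where
  toFun f := BoundedContinuousFunction.ofNormedAddCommGroup
    (fun y => ‖y‖ ^ k • iteratedFDeriv ℝ n f y)
    ((continuous_norm.pow k).smul ((f.smooth n).continuous_iteratedFDeriv le_rfl))
    (SchwartzMap.seminorm ℂ k n f) (fun y => by
      rw [norm_smul, norm_pow, norm_norm]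
      exact SchwartzMap.le_seminorm ℂ k n f y)
  map_add' f g := by
    refine BoundedContinuousFunction.ext fun y => ?_
    change ‖y‖ ^ k • iteratedFDeriv ℝ n (⇑f + ⇑g) y =
      ‖y‖ ^ k • iteratedFDeriv ℝ n f y + ‖y‖ ^ k • iteratedFDeriv ℝ n g y
    rw [← smul_add, iteratedFDeriv_add_apply (f.smooth n).contDiffAt (g.smooth n).contDiffAt]
  map_smul' c f := by
    refine BoundedContinuousFunction.ext fun y => ?_
    change ‖y‖ ^ k • iteratedFDeriv ℝ n (c • ⇑f) y = c • ‖y‖ ^ k • iteratedFDeriv ℝ n f y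
    rw [smul_comm, iteratedFDeriv_const_smul_apply (f.smooth n).contDiffAt]

theorem norm_weightedIteratedFDeriv_le (k n : ℕ) (f : 𝓢(V, ℂ)) :
    ‖weightedIteratedFDeriv k n f‖ ≤ SchwartzMap.seminorm ℂ k n f :=
  (BoundedContinuousFunction.norm_le (apply_nonneg _ _)).2 fun y => by
    change ‖‖y‖ ^ k • iteratedFDeriv ℝ n f y‖ ≤ _
    rw [norm_smul, norm_pow, norm_norm]
    exact SchwartzMap.le_seminorm ℂ k n f y

theorem seminorm_le_norm_weightedIteratedFDeriv (k n : ℕ) (f : 𝓢(V, ℂ)) :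
    SchwartzMap.seminorm ℂ k n f ≤ ‖weightedIteratedFDeriv k n f‖ := by
  refine SchwartzMap.seminorm_le_bound ℂ k n f (norm_nonneg (weightedIteratedFDeriv k n f)) fun y => ?_
  have := (show BoundedContinuousFunction V (V [×n]→L[ℝ] ℂ) from
    weightedIteratedFDeriv k n f).norm_coe_le_norm y
  change ‖‖y‖ ^ k • iteratedFDeriv ℝ n f y‖ ≤ _ at this
  rwa [norm_smul, norm_pow, norm_norm] at this

end SchwartzMap

/-- Hahn–Banach: injectivity of `J` makes `u` a functional on the range of `J`, bounded by
hypothesis, and it extends to all of `E`. -/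
theorem exists_strongDual_comp_eq {M E : Type*} [AddCommGroup M] [Module ℂ M]
    [NormedAddCommGroup E] [NormedSpace ℂ E] (J : M →ₗ[ℂ] E) (hJ : Function.Injective J)
    (u : M →ₗ[ℂ] ℂ) (C : ℝ) (hu : ∀ f, ‖u f‖ ≤ C * ‖J f‖) :
    ∃ L : StrongDual ℂ E, ∀ f, L (J f) = u f := by
  let e := LinearEquiv.ofInjective J hJ
  let ℓ : StrongDual ℂ (LinearMap.range J) :=
    (u ∘ₗ (e.symm : LinearMap.range J →ₗ[ℂ] M)).mkContinuous C
      (fun x => by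
        have h1 := hu (e.symm x)
        have h2 : J (e.symm x) = x := congrArg Subtype.val (e.apply_symm_apply x)
        rw [h2] at h1
        exact h1)
  obtain ⟨L, hL, -⟩ := exists_extension_norm_eq _ ℓ
  refine ⟨L, fun f => ?_⟩
  have h1 := hL (e f)
  have h2 : ℓ (e f) = u (e.symm (e f)) := rfl
  rw [e.symm_apply_apply] at h2
  rw [← h2, ← h1]
  rfl

/-- Tempered distributions commute with integrals of families of Schwartz functions. -/
theorem TemperedDistribution.apply_eq_integral {F : W → 𝓢(V, ℂ)}
    (hF : IsSchwartzIntegrable μ F) {φ : 𝓢(V, ℂ)} (hφ : ∀ y, φ y = ∫ w, F w y ∂μ)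
    (u : 𝓢'(V, ℂ)) : u φ = ∫ w, u (F w) ∂μ := by
  classical
  obtain ⟨s, C, -, hC⟩ := Seminorm.bound_of_continuous (schwartz_withSeminorms ℂ V ℂ)
    ((normSeminorm ℂ ℂ).comp (u : 𝓢(V, ℂ) →ₗ[ℂ] ℂ))
    (by exact continuous_norm.comp (map_continuous u))
  -- Continuity of `u` involves only finitely many seminorms, so `u` factors through a Banach space,
  -- where Bochner integrals commute with functionals. Adding the sup norm, index (0, 0), makes the
  -- embedding `J` injective.
  let t := insert (0, 0) s
  let J : 𝓢(V, ℂ) →ₗ[ℂ] ((i : t) → SchwartzMap.BoundedForms V i.1.2) :=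
    LinearMap.pi fun i => SchwartzMap.weightedIteratedFDeriv i.1.1 i.1.2
  have hJ : ∀ i ∈ t, ∀ f, SchwartzMap.seminorm ℂ i.1 i.2 f ≤ ‖J f‖ := fun i hi f =>
    (SchwartzMap.seminorm_le_norm_weightedIteratedFDeriv i.1 i.2 f).trans
      (norm_le_pi_norm (J f) ⟨i, hi⟩)
  have hJle : ∀ f, ‖J f‖ ≤ ∑ i ∈ t, SchwartzMap.seminorm ℂ i.1 i.2 f := fun f => by
    refine (pi_norm_le_iff_of_nonneg (Finset.sum_nonneg fun i _ => apply_nonneg _ _)).2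
      fun i => (SchwartzMap.norm_weightedIteratedFDeriv_le i.1.1 i.1.2 f).trans ?_
    exact Finset.single_le_sum (f := fun i : ℕ × ℕ => SchwartzMap.seminorm ℂ i.1 i.2 f)
      (fun i _ => apply_nonneg _ _) i.2
  have hJinj : Function.Injective J := by
    rw [injective_iff_map_eq_zero]
    intro f hf
    ext y
    have h1 := hJ (0, 0) (Finset.mem_insert_self _ _) f
    have h2 : ‖J f‖ = 0 := by rw [hf]; exact norm_zero
    rw [h2] at h1
    simpa using (SchwartzMap.norm_le_seminorm ℂ f y).trans h1
  have hu : ∀ f, ‖u f‖ ≤ C * ‖J f‖ := fun f => by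
    refine (hC f).trans (mul_le_mul_of_nonneg_left ?_ C.2)
    refine Seminorm.finset_sup_apply_le (norm_nonneg _) fun i hi => ?_
    exact hJ i (Finset.mem_insert_of_mem hi) f
  have hJc : Continuous J := by
    refine WithSeminorms.continuous_normedSpace_rng
      ((i : t) → SchwartzMap.BoundedForms V i.1.2) (schwartz_withSeminorms ℂ V ℂ) J
      ⟨t, (t.card : ℝ≥0), fun f => ?_⟩
    refine (hJle f).trans ((Finset.sum_le_card_nsmul _ _
      ((t.sup (schwartzSeminormFamily ℂ V ℂ)) f) fun i hi => ?_).trans_eq ?_)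
    · exact Seminorm.le_finset_sup_apply (p := schwartzSeminormFamily ℂ V ℂ) hi
    · rw [nsmul_eq_mul]; rfl
  obtain ⟨L, hLu⟩ := exists_strongDual_comp_eq J hJinj (u : 𝓢(V, ℂ) →ₗ[ℂ] ℂ) C hu
  have hint : Integrable (fun w => J (F w)) μ := by
    refine Integrable.mono' (integrable_finsetSum t fun i _ => hF.integrable i.1 i.2)
      (hJc.comp hF.continuous).aestronglyMeasurable (Filter.Eventually.of_forall fun w => ?_)
    exact hJle (F w)
  -- The hypothesis is only the pointwise identity for φ. Evaluating each component at a point and a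
  -- tuple reduces the Banach-valued identity to differentiation under the integral.
  have hφJ : J φ = ∫ w, J (F w) ∂μ := by
    funext i
    refine SchwartzMap.BoundedForms.ext_eval fun y m => ?_
    have h1 := ((SchwartzMap.BoundedForms.eval y m) ∘L (ContinuousLinearMap.proj (R := ℂ)
      (φ := fun i : t => SchwartzMap.BoundedForms V i.1.2) i)).integral_comp_comm hint
    have h2 := ((IsSchwartzIntegrable.iteratedLineDerivOp_eq_integral i.1.2 m hF hφ).2 y)
    simp only [SchwartzMap.iteratedLineDerivOp_eq_iteratedFDeriv] at h2
    refine Eq.trans ?_ h1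
    change ‖y‖ ^ i.1.1 • iteratedFDeriv ℝ i.1.2 φ y m =
      ∫ w, ‖y‖ ^ i.1.1 • iteratedFDeriv ℝ i.1.2 (F w) y m ∂μ
    rw [h2, integral_smul]
  have h1 := L.integral_comp_comm hint
  rw [← hφJ] at h1
  simp only [hLu] at h1
  exact h1.symm

end WeakIntegral

/-! ### Continuity and polynomial growth of time-frequency shifts in the Schwartz topology. -/

section TimeFrequencyShifts

open Filter Topology

namespace SchwartzMap

section Translation

variable {V : Type*} [NormedAddCommGroup V] [NormedSpace ℝ V]

theorem norm_pow_le_sub_add (x y : V) (k : ℕ) :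
    ‖y‖ ^ k ≤ 2 ^ (k - 1) * (‖y - x‖ ^ k + ‖x‖ ^ k) := by
  refine le_trans ?_ (add_pow_le (norm_nonneg _) (norm_nonneg _) k)
  gcongr
  simpa using norm_add_le (y - x) x

theorem seminorm_compSubConstCLM_le (f : 𝓢(V, ℂ)) (a : V) (k n : ℕ) :
    SchwartzMap.seminorm ℂ k n (f.compSubConstCLM ℂ a) ≤
      2 ^ (k - 1) * (SchwartzMap.seminorm ℂ k n f + ‖a‖ ^ k * SchwartzMap.seminorm ℂ 0 n f) := by
  refine SchwartzMap.seminorm_le_bound ℂ k n _ (by positivity) fun y => ?_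
  have h1 : iteratedFDeriv ℝ n (f.compSubConstCLM ℂ a) y = iteratedFDeriv ℝ n f (y - a) :=
    iteratedFDeriv_comp_sub n a y
  rw [h1]
  have h2 := SchwartzMap.le_seminorm ℂ k n f (y - a)
  have h3 := SchwartzMap.norm_iteratedFDeriv_le_seminorm ℂ f n (y - a)
  calc ‖y‖ ^ k * ‖iteratedFDeriv ℝ n f (y - a)‖
      ≤ 2 ^ (k - 1) * (‖y - a‖ ^ k + ‖a‖ ^ k) * ‖iteratedFDeriv ℝ n f (y - a)‖ := by
        gcongr; exact norm_pow_le_sub_add a y k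
    _ = 2 ^ (k - 1) * (‖y - a‖ ^ k * ‖iteratedFDeriv ℝ n f (y - a)‖ +
          ‖a‖ ^ k * ‖iteratedFDeriv ℝ n f (y - a)‖) := by ring
    _ ≤ _ := by gcongr

/-- Mean value inequality on the segment from `y` to `y - h`: its points `z` satisfy `‖y - z‖ ≤
‖h‖`, so the weight at `y` is controlled by the weight at `z`. -/
theorem seminorm_compSubConstCLM_sub_le (f : 𝓢(V, ℂ)) (h : V) (k n : ℕ) :
    SchwartzMap.seminorm ℂ k n (f.compSubConstCLM ℂ h - f) ≤
      2 ^ (k - 1) * (SchwartzMap.seminorm ℂ k (n + 1) f +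
        ‖h‖ ^ k * SchwartzMap.seminorm ℂ 0 (n + 1) f) * ‖h‖ := by
  refine SchwartzMap.seminorm_le_bound ℂ k n _ (by positivity) fun y => ?_
  have h1 : iteratedFDeriv ℝ n (f.compSubConstCLM ℂ h) y = iteratedFDeriv ℝ n f (y - h) :=
    iteratedFDeriv_comp_sub n h y
  have h2 : iteratedFDeriv ℝ n (f.compSubConstCLM ℂ h - f : 𝓢(V, ℂ)) y =
      iteratedFDeriv ℝ n f (y - h) - iteratedFDeriv ℝ n f y := by
    rw [← h1]
    exact iteratedFDeriv_sub_apply ((f.compSubConstCLM ℂ h).smooth n).contDiffAt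
      (f.smooth n).contDiffAt
  rw [h2]
  have hdiff : Differentiable ℝ (iteratedFDeriv ℝ n f) :=
    (f.smooth (n + 1 : ℕ)).differentiable_iteratedFDeriv (by exact_mod_cast Nat.lt_succ_self n)
  have key := Convex.norm_image_sub_le_of_norm_fderiv_le (𝕜 := ℝ)
    (f := fun z => ‖y‖ ^ k • iteratedFDeriv ℝ n f z) (s := segment ℝ y (y - h))
    (C := 2 ^ (k - 1) * (SchwartzMap.seminorm ℂ k (n + 1) f +
        ‖h‖ ^ k * SchwartzMap.seminorm ℂ 0 (n + 1) f))
    (fun z _ => (hdiff z).fun_const_smul _) (fun z hz => ?_) (convex_segment _ _)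
    (left_mem_segment ℝ _ _) (right_mem_segment ℝ _ _)
  · rw [← smul_sub, norm_smul, norm_pow, norm_norm] at key
    simpa using key
  · rw [fderiv_fun_const_smul (hdiff z), norm_smul, norm_pow, norm_norm, norm_fderiv_iteratedFDeriv]
    have h4 : ‖y - z‖ ≤ ‖h‖ := by
      obtain ⟨a, b, ha, hb, hab, rfl⟩ := hz
      have : y - (a • y + b • (y - h)) = b • h := by
        have : y = (a + b) • y := by rw [hab, one_smul]
        nth_rewrite 1 [this]
        module
      rw [this, norm_smul, Real.norm_of_nonneg hb]
      exact mul_le_of_le_one_left (norm_nonneg _) (by linarith)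
    have h5 : ‖y‖ ^ k ≤ 2 ^ (k - 1) * (‖z‖ ^ k + ‖h‖ ^ k) := by
      refine le_trans ?_ (add_pow_le (norm_nonneg _) (norm_nonneg _) k)
      gcongr
      calc ‖y‖ = ‖z + (y - z)‖ := by congr 1; abel
        _ ≤ ‖z‖ + ‖y - z‖ := norm_add_le _ _
        _ ≤ _ := by gcongr
    have h2 := SchwartzMap.le_seminorm ℂ k (n + 1) f z
    have h3 := SchwartzMap.norm_iteratedFDeriv_le_seminorm ℂ f (n + 1) z
    calc ‖y‖ ^ k * ‖iteratedFDeriv ℝ (n + 1) f z‖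
        ≤ 2 ^ (k - 1) * (‖z‖ ^ k + ‖h‖ ^ k) * ‖iteratedFDeriv ℝ (n + 1) f z‖ := by gcongr
      _ = 2 ^ (k - 1) * (‖z‖ ^ k * ‖iteratedFDeriv ℝ (n + 1) f z‖ +
            ‖h‖ ^ k * ‖iteratedFDeriv ℝ (n + 1) f z‖) := by ring
      _ ≤ _ := by gcongr

theorem tendsto_of_seminorm {α : Type*} {l : Filter α} {F : α → 𝓢(V, ℂ)} {f : 𝓢(V, ℂ)}
    (h : ∀ k n, Tendsto (fun w => SchwartzMap.seminorm ℂ k n (F w - f)) l (𝓝 0)) :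
    Tendsto F l (𝓝 f) :=
  ((schwartz_withSeminorms ℂ V ℂ).tendsto_nhds F f).2 fun i _ε hε =>
    (h i.1 i.2).eventually (gt_mem_nhds hε)

/-- The increment splits into `F w - F w₀` translated by `a w`, small because translation bounds are
locally uniform, and the fixed function `F w₀` translated by the small vector `a w - a w₀`, followed
by the fixed translation by `a w₀`. -/
theorem _root_.Continuous.compSubConstCLM {W : Type*} [TopologicalSpace W] {a : W → V}
    {F : W → 𝓢(V, ℂ)} (ha : Continuous a) (hF : Continuous F) :
    Continuous fun w => (F w).compSubConstCLM ℂ (a w) := by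
  refine continuous_iff_continuousAt.2 fun w₀ => ?_
  have hp : ∀ k n, Tendsto (fun w => SchwartzMap.seminorm ℂ k n (F w - F w₀)) (𝓝 w₀) (𝓝 0) := by
    intro k n
    have h1 : Continuous fun w => SchwartzMap.seminorm ℂ k n (F w - F w₀) :=
      ((schwartz_withSeminorms ℂ V ℂ).continuous_seminorm (k, n)).comp (hF.sub continuous_const)
    simpa using h1.tendsto w₀
  have h1 : Tendsto (fun w => (F w - F w₀).compSubConstCLM ℂ (a w)) (𝓝 w₀) (𝓝 0) := by
    refine tendsto_of_seminorm fun k n => ?_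
    refine squeeze_zero (fun _ => apply_nonneg _ _) (g := fun w => 2 ^ (k - 1) *
      (SchwartzMap.seminorm ℂ k n (F w - F w₀) + ‖a w‖ ^ k *
        SchwartzMap.seminorm ℂ 0 n (F w - F w₀))) (fun w => ?_) ?_
    · rw [sub_zero]
      exact seminorm_compSubConstCLM_le _ _ _ _
    · simpa using ((hp k n).add (((ha.norm.pow k).tendsto w₀).mul (hp 0 n))).const_mul
        ((2 : ℝ) ^ (k - 1))
  have h2 : Tendsto (fun w => (F w₀).compSubConstCLM ℂ (a w - a w₀)) (𝓝 w₀) (𝓝 (F w₀)) := by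
    have h0 : Tendsto (fun w => ‖a w - a w₀‖) (𝓝 w₀) (𝓝 0) := by
      simpa using ((ha.sub (continuous_const (y := a w₀))).norm.tendsto w₀)
    refine tendsto_of_seminorm fun k n => ?_
    refine squeeze_zero (fun _ => apply_nonneg _ _)
      (fun w => seminorm_compSubConstCLM_sub_le _ _ _ _) ?_
    simpa using ((((h0.pow k).mul_const (SchwartzMap.seminorm ℂ 0 (n + 1) (F w₀))).const_add
      (SchwartzMap.seminorm ℂ k (n + 1) (F w₀))).const_mul ((2 : ℝ) ^ (k - 1))).mul h0
  have h3 := h1.add (((SchwartzMap.compSubConstCLM ℂ (a w₀)).continuous.tendsto (F w₀)).comp h2)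
  rw [zero_add] at h3
  refine h3.congr fun w => ?_
  simp only [Function.comp_apply, compSubConstCLM_comp, map_sub, sub_add_cancel]

/-- All seminorms of the family `F` grow at most polynomially. -/
def PolynomiallyBounded {W : Type*} [NormedAddCommGroup W] (F : W → 𝓢(V, ℂ)) : Prop :=
  ∀ k n, ∃ (C : ℝ) (N : ℕ), 0 ≤ C ∧ ∀ w, SchwartzMap.seminorm ℂ k n (F w) ≤ C * (1 + ‖w‖) ^ N

namespace PolynomiallyBounded

variable {W : Type*} [NormedAddCommGroup W] {F : W → 𝓢(V, ℂ)}

theorem const (f : 𝓢(V, ℂ)) : PolynomiallyBounded fun _ : W => f := fun k n =>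
  ⟨SchwartzMap.seminorm ℂ k n f, 0, apply_nonneg _ _, fun w => by simp⟩

theorem exists_sum_le (hF : PolynomiallyBounded F) (s : Finset (ℕ × ℕ)) :
    ∃ (C : ℝ) (N : ℕ), 0 ≤ C ∧
      ∀ w, ∑ i ∈ s, SchwartzMap.seminorm ℂ i.1 i.2 (F w) ≤ C * (1 + ‖w‖) ^ N := by
  classical
  induction s using Finset.induction_on with
  | empty => exact ⟨0, 0, le_rfl, fun w => by simp⟩
  | insert i s hi ih =>
    obtain ⟨C, N, hC, h⟩ := ih
    obtain ⟨C', N', hC', h'⟩ := hF i.1 i.2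
    refine ⟨C' + C, N' + N, add_nonneg hC' hC, fun w => ?_⟩
    have h1 : 1 ≤ 1 + ‖w‖ := by linarith [norm_nonneg w]
    rw [Finset.sum_insert hi, add_mul]
    refine add_le_add ((h' w).trans ?_) ((h w).trans ?_)
    · gcongr
      · exact Nat.le_add_right _ _
    · gcongr
      · exact Nat.le_add_left _ _

theorem clm_comp (hF : PolynomiallyBounded F) (L : 𝓢(V, ℂ) →L[ℂ] 𝓢(V, ℂ)) :
    PolynomiallyBounded fun w => L (F w) := by
  intro k n
  obtain ⟨s, C, hC, h⟩ := SchwartzMap.exists_seminorm_clm_le L k n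
  obtain ⟨C', N, hC', h'⟩ := hF.exists_sum_le s
  refine ⟨C * C', N, mul_nonneg hC hC', fun w => (h (F w)).trans ?_⟩
  rw [mul_assoc]
  exact mul_le_mul_of_nonneg_left (h' w) hC

theorem compSubConstCLM (hF : PolynomiallyBounded F) {a : W → V} (ha : ∀ w, ‖a w‖ ≤ ‖w‖) :
    PolynomiallyBounded fun w => (F w).compSubConstCLM ℂ (a w) := by
  intro k n
  obtain ⟨C, N, hC, h⟩ := hF k n
  obtain ⟨C', N', hC', h'⟩ := hF 0 n
  refine ⟨2 ^ (k - 1) * (C + C'), N + (k + N'), by positivity, fun w => ?_⟩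
  refine (seminorm_compSubConstCLM_le _ _ _ _).trans ?_
  rw [mul_assoc, add_mul]
  have h1 : 1 ≤ 1 + ‖w‖ := by linarith [norm_nonneg w]
  refine mul_le_mul_of_nonneg_left (add_le_add ((h w).trans ?_) ?_) (by positivity)
  · exact mul_le_mul_of_nonneg_left (pow_le_pow_right₀ h1 (by omega)) hC
  · calc ‖a w‖ ^ k * SchwartzMap.seminorm ℂ 0 n (F w)
        ≤ (1 + ‖w‖) ^ k * (C' * (1 + ‖w‖) ^ N') := by
          gcongr
          · exact (ha w).trans (by linarith)
          · exact h' w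
      _ = C' * (1 + ‖w‖) ^ (k + N') := by ring
      _ ≤ _ := mul_le_mul_of_nonneg_left (pow_le_pow_right₀ h1 (by omega)) hC'

end PolynomiallyBounded

end Translation

end SchwartzMap

section Modulation

variable {V : Type*} [NormedAddCommGroup V] [InnerProductSpace ℝ V]

theorem norm_modChar (ω y : V) : ‖modChar ω y‖ = 1 := by
  rw [modChar, Complex.norm_exp]
  simp

theorem modChar_add (ω ω' y : V) : modChar (ω + ω') y = modChar ω y * modChar ω' y := by
  simp only [modChar, ← Complex.exp_add, inner_add_right]
  push_cast
  ring_nf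

theorem modChar_add_right (ω y y' : V) : modChar ω (y + y') = modChar ω y * modChar ω y' := by
  simp only [modChar, ← Complex.exp_add, inner_add_left]
  push_cast
  ring_nf

theorem conj_modChar (ω y : V) : (starRingEnd ℂ) (modChar ω y) = modChar (-ω) y := by
  simp only [modChar, ← Complex.exp_conj]
  congr 1
  simp only [map_mul, Complex.conj_ofReal, Complex.conj_I, inner_neg_right, Complex.ofReal_neg,
    Complex.conj_ofNat]
  ring

theorem schwartzConj_tfShift (x ω : V) (g : 𝓢(V, ℂ)) :
    schwartzConj (tfShift x ω g) = tfShift x (-ω) (schwartzConj g) := by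
  ext y
  simp only [schwartzConj_apply, tfShift_apply, map_mul, conj_modChar]

theorem schwartzConj_schwartzConj (g : 𝓢(V, ℂ)) : schwartzConj (schwartzConj g) = g := by
  ext y
  simp [schwartzConj_apply]

variable [FiniteDimensional ℝ V] [MeasurableSpace V] [BorelSpace V]

theorem fourier_apply_modChar (f : V → ℂ) (η : V) : 𝓕 f η = ∫ y, modChar (-η) y * f y := by
  rw [Real.fourier_eq']
  refine integral_congr_ae (Eventually.of_forall fun y => ?_)
  simp only [modChar, smul_eq_mul, inner_neg_right]
  push_cast
  ring_nf

theorem fourierInv_apply_modChar (f : V → ℂ) (η : V) : 𝓕⁻ f η = ∫ y, modChar η y * f y := by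
  rw [Real.fourierInv_eq']
  refine integral_congr_ae (Eventually.of_forall fun y => ?_)
  simp only [modChar, smul_eq_mul]
  push_cast
  ring_nf

theorem fourier_modChar_smul (ω : V) (f : 𝓢(V, ℂ)) :
    𝓕 (SchwartzMap.smulLeftCLM ℂ (modChar ω) f) = (𝓕 f).compSubConstCLM ℂ ω := by
  ext η
  rw [SchwartzMap.compSubConstCLM_apply, SchwartzMap.fourier_coe, SchwartzMap.fourier_coe,
    fourier_apply_modChar, fourier_apply_modChar]
  refine integral_congr_ae (Eventually.of_forall fun y => ?_)
  simp only [SchwartzMap.smulLeftCLM_apply_apply (modChar_hasTemperateGrowth ω), smul_eq_mul,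
    ← mul_assoc, ← modChar_add]
  congr 2
  abel

/-- A modulation is a translation conjugated by the Fourier transform, so continuity and growth of
time-frequency shifts follow from those of translations. -/
theorem tfShift_eq_fourierInv (x ω : V) (g : 𝓢(V, ℂ)) :
    tfShift x ω g = 𝓕⁻ ((𝓕 (g.compSubConstCLM ℂ x)).compSubConstCLM ℂ ω) := by
  rw [← fourier_modChar_smul, FourierTransform.fourierInv_fourier_eq]
  rfl

theorem continuous_tfShift (g : 𝓢(V, ℂ)) : Continuous fun z : V × V => tfShift z.1 z.2 g := by
  simp only [tfShift_eq_fourierInv]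
  exact (FourierTransform.fourierInvCLM ℂ 𝓢(V, ℂ)).continuous.comp
    (Continuous.compSubConstCLM continuous_snd
      ((FourierTransform.fourierCLM ℂ 𝓢(V, ℂ)).continuous.comp
        (Continuous.compSubConstCLM continuous_fst continuous_const)))

theorem polynomiallyBounded_tfShift (g : 𝓢(V, ℂ)) :
    SchwartzMap.PolynomiallyBounded fun z : V × V => tfShift z.1 z.2 g := by
  simp only [tfShift_eq_fourierInv]
  exact ((((SchwartzMap.PolynomiallyBounded.const g).compSubConstCLM
    (a := Prod.fst) norm_fst_le).clm_comp (FourierTransform.fourierCLM ℂ 𝓢(V, ℂ))).compSubConstCLM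
    (a := Prod.snd) norm_snd_le).clm_comp (FourierTransform.fourierInvCLM ℂ 𝓢(V, ℂ))

theorem continuous_stft (g : 𝓢(V, ℂ)) (u : 𝓢'(V, ℂ)) :
    Continuous fun z : V × V => stft g u z.1 z.2 := by
  simp only [stft, schwartzConj_tfShift]
  exact (map_continuous u).comp ((continuous_tfShift (schwartzConj g)).comp
    (continuous_fst.prodMk continuous_snd.neg))

end Modulation

end TimeFrequencyShifts

/-! ### Decay of short-time Fourier transforms and the reproducing formula. -/

section ReproducingFormula

open Filter Topology

variable {V : Type*} [NormedAddCommGroup V]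

/-- The polynomially decaying weight `(1 + |x|)^{-N}`. -/
noncomputable def decayWeight (N : ℕ) (x : V) : ℝ := ((1 + ‖x‖) ^ N)⁻¹

theorem one_le_one_add_norm (x : V) : 1 ≤ 1 + ‖x‖ := by linarith [norm_nonneg x]

theorem decayWeight_pos (N : ℕ) (x : V) : 0 < decayWeight N x := by
  have := one_le_one_add_norm x
  unfold decayWeight
  positivity

theorem decayWeight_le_one (N : ℕ) (x : V) : decayWeight N x ≤ 1 :=
  inv_le_one_of_one_le₀ (one_le_pow₀ (one_le_one_add_norm x))

theorem continuous_decayWeight (N : ℕ) : Continuous (decayWeight N : V → ℝ) := by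
  refine Continuous.inv₀ (by fun_prop) fun x => ?_
  have := one_le_one_add_norm x
  positivity

theorem decayWeight_neg (N : ℕ) (x : V) : decayWeight N (-x) = decayWeight N x := by
  simp [decayWeight]

theorem pow_mul_decayWeight_add (M N : ℕ) (x : V) :
    (1 + ‖x‖) ^ M * decayWeight (M + N) x = decayWeight N x := by
  have := one_le_one_add_norm x
  unfold decayWeight
  rw [pow_add, mul_inv, ← mul_assoc, mul_inv_cancel₀ (by positivity), one_mul]

variable [InnerProductSpace ℝ V] [FiniteDimensional ℝ V] [MeasurableSpace V] [BorelSpace V]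

theorem integrable_decayWeight {N : ℕ} (hN : Module.finrank ℝ V < N) :
    Integrable (decayWeight N : V → ℝ) := by
  have h := integrable_one_add_norm (E := V) (μ := volume) (r := N) (by exact_mod_cast hN)
  refine h.congr (Eventually.of_forall fun x => ?_)
  have := one_le_one_add_norm x
  simp only [decayWeight]
  rw [Real.rpow_neg (by positivity), Real.rpow_natCast]

theorem SchwartzMap.exists_norm_le_decayWeight (f : 𝓢(V, ℂ)) (N : ℕ) :
    ∃ C : ℝ, 0 ≤ C ∧ ∀ y, ‖f y‖ ≤ C * decayWeight N y := by
  refine ⟨2 ^ N * ((Finset.Iic (N, 0)).sup fun m => SchwartzMap.seminorm ℂ m.1 m.2) f,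
    by positivity, fun y => ?_⟩
  have h := SchwartzMap.one_add_le_sup_seminorm_apply (𝕜 := ℂ) (m := (N, 0)) (k := N) (n := 0)
    le_rfl le_rfl f y
  rw [norm_iteratedFDeriv_zero] at h
  have := one_le_one_add_norm y
  rw [decayWeight, ← div_eq_mul_inv, le_div_iff₀ (by positivity), mul_comm]
  exact h

/-- Since `1 + ‖a - b‖ ≤ (1 + ‖y - a‖)(1 + ‖y - b‖)`, the weight can be shared between the two
factors, each of which decays fast enough to absorb it. -/
theorem SchwartzMap.exists_integral_translate_mul_le (f g : 𝓢(V, ℂ)) (N : ℕ) :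
    ∃ C : ℝ, 0 ≤ C ∧ ∀ a b : V,
      (1 + ‖a - b‖) ^ N * ∫ y, ‖f (y - a)‖ * ‖g (y - b)‖ ≤ C := by
  obtain ⟨Cg, hCg, hg⟩ := g.exists_norm_le_decayWeight N
  obtain ⟨Cf, hCf, hf⟩ := f.exists_norm_le_decayWeight (N + (Module.finrank ℝ V + 1))
  have hI : Integrable fun y => (1 + ‖y‖) ^ N * ‖f y‖ * Cg := by
    refine Integrable.mono' (((integrable_decayWeight (V := V) (N := Module.finrank ℝ V + 1)
      (Nat.lt_succ_self _)).const_mul Cf).mul_const Cg) (by fun_prop) (Eventually.of_forall fun y => ?_)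
    rw [Real.norm_of_nonneg (by positivity), ← pow_mul_decayWeight_add N]
    refine mul_le_mul_of_nonneg_right ?_ hCg
    have h1 := mul_le_mul_of_nonneg_left (hf y) (by positivity : 0 ≤ (1 + ‖y‖) ^ N)
    calc _ ≤ _ := h1
      _ = _ := by ring
  refine ⟨∫ y, (1 + ‖y‖) ^ N * ‖f y‖ * Cg, integral_nonneg fun y => by positivity,
    fun a b => ?_⟩
  rw [← integral_const_mul]
  refine le_trans ?_ (integral_sub_right_eq_self (fun y => (1 + ‖y‖) ^ N * ‖f y‖ * Cg) a).le
  refine integral_mono_of_nonneg (Eventually.of_forall fun y => by positivity) (hI.comp_sub_right a)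
    (Eventually.of_forall fun y => ?_)
  have h1 : (1 + ‖a - b‖) ^ N ≤ (1 + ‖y - a‖) ^ N * (1 + ‖y - b‖) ^ N := by
    rw [← mul_pow]
    gcongr
    have h2 : ‖a - b‖ ≤ ‖y - a‖ + ‖y - b‖ := by
      rw [← norm_neg (y - a)]
      have h3 : a - b = -(y - a) + (y - b) := by abel
      rw [h3]
      exact norm_add_le _ _
    nlinarith [norm_nonneg (y - a), norm_nonneg (y - b)]
  have h3 : (1 + ‖y - b‖) ^ N * ‖g (y - b)‖ ≤ Cg := by
    have := one_le_one_add_norm (y - b)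
    have h4 := hg (y - b)
    rw [decayWeight, ← div_eq_mul_inv, le_div_iff₀ (by positivity), mul_comm] at h4
    exact h4
  calc (1 + ‖a - b‖) ^ N * (‖f (y - a)‖ * ‖g (y - b)‖)
      ≤ ((1 + ‖y - a‖) ^ N * (1 + ‖y - b‖) ^ N) * (‖f (y - a)‖ * ‖g (y - b)‖) := by gcongr
    _ = ((1 + ‖y - a‖) ^ N * ‖f (y - a)‖) * ((1 + ‖y - b‖) ^ N * ‖g (y - b)‖) := by ring
    _ ≤ (1 + ‖y - a‖) ^ N * ‖f (y - a)‖ * Cg := by gcongr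

theorem norm_stft_schwartz_le (g f : 𝓢(V, ℂ)) (x ω : V) :
    ‖stft g (f : 𝓢'(V, ℂ)) x ω‖ ≤ ∫ y, ‖f y‖ * ‖g (y - x)‖ := by
  rw [stft_schwartz]
  refine (norm_integral_le_integral_norm _).trans_eq ?_
  simp only [norm_mul, RCLike.norm_conj, norm_modChar, one_mul]

theorem fourier_compSubConstCLM (x : V) (f : 𝓢(V, ℂ)) (η : V) :
    𝓕 (f.compSubConstCLM ℂ x) η = modChar (-η) x * 𝓕 f η := by
  rw [SchwartzMap.fourier_coe, SchwartzMap.fourier_coe, fourier_apply_modChar,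
    fourier_apply_modChar, ← integral_const_mul,
    ← integral_sub_right_eq_self (fun y => modChar (-η) x * (modChar (-η) y * f y)) x]
  refine integral_congr_ae (Eventually.of_forall fun y => ?_)
  simp only [SchwartzMap.compSubConstCLM_apply, ← mul_assoc, ← modChar_add_right]
  congr 2
  abel

theorem fourier_tfShift (x ω : V) (f : 𝓢(V, ℂ)) (η : V) :
    𝓕 (tfShift x ω f) η = modChar (-(η - ω)) x * 𝓕 f (η - ω) := by
  rw [tfShift, fourier_modChar_smul, SchwartzMap.compSubConstCLM_apply, fourier_compSubConstCLM]

theorem norm_fourier_tfShift (x ω : V) (f : 𝓢(V, ℂ)) (η : V) :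
    ‖𝓕 (tfShift x ω f) η‖ = ‖𝓕 f (η - ω)‖ := by
  rw [fourier_tfShift, norm_mul, norm_modChar, one_mul]

theorem norm_tfShift (x ω : V) (f : 𝓢(V, ℂ)) (y : V) :
    ‖tfShift x ω f y‖ = ‖f (y - x)‖ := by
  rw [tfShift_apply, norm_mul, norm_modChar, one_mul]

/-- By Parseval, the transform is also an inner product on the Fourier side, where ω is the
translation parameter. -/
theorem norm_stft_schwartz_le_fourier (g f : 𝓢(V, ℂ)) (x ω : V) :
    ‖stft g (f : 𝓢'(V, ℂ)) x ω‖ ≤ ∫ η, ‖𝓕 f η‖ * ‖𝓕 g (η - ω)‖ := by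
  have h : stft g (f : 𝓢'(V, ℂ)) x ω = ∫ y, inner ℂ (tfShift x ω g y) (f y) := by
    rw [stft, SchwartzMap.coe_apply]
    refine integral_congr_ae (Eventually.of_forall fun y => ?_)
    simp [schwartzConj_apply, mul_comm]
  rw [h, ← SchwartzMap.integral_inner_fourier_fourier]
  refine (norm_integral_le_integral_norm _).trans_eq ?_
  refine integral_congr_ae (Eventually.of_forall fun η => ?_)
  simp only [RCLike.inner_apply, norm_mul, RCLike.norm_conj, norm_fourier_tfShift]

theorem exists_norm_stft_tfShift_le (g f : 𝓢(V, ℂ)) (N : ℕ) :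
    ∃ C : ℝ, 0 ≤ C ∧ ∀ x ω x' ω' : V,
      ‖stft g (tfShift x ω f : 𝓢'(V, ℂ)) x' ω'‖ ≤
        C * (decayWeight N (x - x') * decayWeight N (ω - ω')) := by
  -- The time side gives decay in `x - x'` only, the Fourier side decay in `ω - ω'` only. Taking
  -- order `2 * N` in each, the product weight follows from `2ab ≤ a² + b²`.
  obtain ⟨C₁, hC₁, h₁⟩ := f.exists_integral_translate_mul_le g (2 * N)
  obtain ⟨C₂, hC₂, h₂⟩ := (𝓕 f).exists_integral_translate_mul_le (𝓕 g) (2 * N)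
  refine ⟨(C₁ + C₂) / 2, by positivity, fun x ω x' ω' => ?_⟩
  have ha := one_le_one_add_norm (x - x')
  have hb := one_le_one_add_norm (ω - ω')
  have h3 := norm_stft_schwartz_le g (tfShift x ω f) x' ω'
  have h4 := norm_stft_schwartz_le_fourier g (tfShift x ω f) x' ω'
  simp only [norm_tfShift] at h3
  simp only [norm_fourier_tfShift] at h4
  rw [decayWeight, decayWeight, ← mul_inv, ← div_eq_mul_inv, le_div_iff₀ (by positivity)]
  have h5 := (mul_le_mul_of_nonneg_left h3 (by positivity)).trans (h₁ x x')
  have h6 := (mul_le_mul_of_nonneg_left h4 (by positivity)).trans (h₂ ω ω')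
  set s := ‖stft g (tfShift x ω f : 𝓢'(V, ℂ)) x' ω'‖
  have hs : 0 ≤ s := norm_nonneg _
  rw [pow_mul', sq] at h5 h6
  nlinarith [mul_nonneg hs (sq_nonneg ((1 + ‖x - x'‖) ^ N - (1 + ‖ω - ω'‖) ^ N))]

theorem tfShift_zero_zero (f : 𝓢(V, ℂ)) : tfShift 0 0 f = f := by
  ext y
  simp [tfShift_apply, modChar]

theorem exists_norm_stft_schwartz_le (g f : 𝓢(V, ℂ)) (N : ℕ) :
    ∃ C : ℝ, 0 ≤ C ∧ ∀ x ω : V,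
      ‖stft g (f : 𝓢'(V, ℂ)) x ω‖ ≤ C * (decayWeight N x * decayWeight N ω) := by
  obtain ⟨C, hC, h⟩ := exists_norm_stft_tfShift_le g f N
  refine ⟨C, hC, fun x ω => ?_⟩
  have := h 0 0 x ω
  rwa [tfShift_zero_zero, zero_sub, zero_sub, decayWeight_neg, decayWeight_neg] at this

theorem integrable_decayWeight_prod {N : ℕ} (hN : Module.finrank ℝ V < N) :
    Integrable fun w : V × V => decayWeight N w.1 * decayWeight N w.2 :=
  (integrable_decayWeight hN).mul_prod (integrable_decayWeight hN)

/-- For fixed x, the transform in ω is the Fourier transform of `f` times the conjugated translate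
of `g`, so this is Fourier inversion. -/
theorem integral_stft_mul_modChar (g f : 𝓢(V, ℂ)) (x y : V) :
    ∫ ω, modChar ω y * stft g (f : 𝓢'(V, ℂ)) x ω = f y * (starRingEnd ℂ) (g (y - x)) := by
  let h : V → ℂ := fun y => f y * (starRingEnd ℂ) (g (y - x))
  have hc : Continuous h := by fun_prop
  have hF : 𝓕 h = fun ω => stft g (f : 𝓢'(V, ℂ)) x ω := by
    funext ω
    rw [fourier_apply_modChar, stft_schwartz]
    refine integral_congr_ae (Eventually.of_forall fun y => ?_)
    simp only [h, conj_modChar, mul_assoc]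
  have hi : Integrable h := by
    obtain ⟨C, hC, hg⟩ := g.exists_norm_le_decayWeight 0
    refine (f.integrable (μ := volume)).norm.mul_const C |>.mono' hc.aestronglyMeasurable
      (Eventually.of_forall fun y => ?_)
    rw [norm_mul, RCLike.norm_conj]
    gcongr
    simpa [decayWeight] using hg (y - x)
  have hFi : Integrable (𝓕 h) := by
    rw [hF]
    obtain ⟨C, hC, hs⟩ := exists_norm_stft_schwartz_le g f (Module.finrank ℝ V + 1)
    refine Integrable.mono' ((integrable_decayWeight (V := V) (Nat.lt_succ_self _)).const_mul C)
      ((continuous_stft g f).comp (Continuous.prodMk_right x)).aestronglyMeasurable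
      (Eventually.of_forall fun ω => (hs x ω).trans ?_)
    gcongr
    exact mul_le_of_le_one_left (decayWeight_pos _ _).le (decayWeight_le_one _ _)
  have h2 := hc.fourierInv_fourier_eq hi hFi
  have h3 := congrFun h2 y
  rw [fourierInv_apply_modChar, hF] at h3
  refine Eq.trans ?_ h3
  refine integral_congr_ae (Eventually.of_forall fun ω => ?_)
  simp only [modChar, real_inner_comm]

/-- Integrating first in ω leaves `f y * ‖g (y - x)‖ ^ 2`, and the integral in x then produces the
squared norm of the window. -/
theorem integral_stft_mul_tfShift (g f : 𝓢(V, ℂ)) (y : V) :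
    ∫ w : V × V, stft g (f : 𝓢'(V, ℂ)) w.1 w.2 * tfShift w.1 w.2 g y =
      ((∫ y, ‖g y‖ ^ 2 : ℝ) : ℂ) * f y := by
  have hi : Integrable fun w : V × V =>
      stft g (f : 𝓢'(V, ℂ)) w.1 w.2 * tfShift w.1 w.2 g y := by
    obtain ⟨C, hC, hg⟩ := g.exists_norm_le_decayWeight 0
    obtain ⟨C', hC', hs⟩ := exists_norm_stft_schwartz_le g f (Module.finrank ℝ V + 1)
    refine Integrable.mono' (((integrable_decayWeight_prod (V := V)
      (Nat.lt_succ_self _)).const_mul C').mul_const C) ?_ (Eventually.of_forall fun w => ?_)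
    · refine ((continuous_stft g f).mul ?_).aestronglyMeasurable
      simp only [tfShift_apply, modChar]
      fun_prop
    · rw [norm_mul, norm_tfShift]
      refine mul_le_mul (hs _ _) ?_ (norm_nonneg _)
        (mul_nonneg hC' (mul_nonneg (decayWeight_pos _ _).le (decayWeight_pos _ _).le))
      simpa [decayWeight] using hg (y - w.1)
  rw [Measure.volume_eq_prod, integral_prod _ hi]
  have h1 : ∀ x : V, ∫ ω : V, stft g (f : 𝓢'(V, ℂ)) x ω * tfShift x ω g y =
      f y * ((‖g (y - x)‖ ^ 2 : ℝ) : ℂ) := by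
    intro x
    have h2 : ∀ ω, stft g (f : 𝓢'(V, ℂ)) x ω * tfShift x ω g y =
        (modChar ω y * stft g (f : 𝓢'(V, ℂ)) x ω) * g (y - x) := by
      intro ω
      rw [tfShift_apply]
      ring
    simp only [h2]
    rw [integral_mul_const, integral_stft_mul_modChar, mul_assoc, mul_comm (starRingEnd ℂ _),
      Complex.mul_conj, Complex.normSq_eq_norm_sq]
  simp only [h1]
  rw [integral_const_mul, integral_complex_ofReal, mul_comm,
    integral_sub_left_eq_self (fun y => ‖g y‖ ^ 2) volume y]

theorem SchwartzMap.integral_norm_sq_pos {g : 𝓢(V, ℂ)} (hg : g ≠ 0) : 0 < ∫ y, ‖g y‖ ^ 2 := by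
  obtain ⟨y, hy⟩ : ∃ y, g y ≠ 0 := by
    by_contra! h
    exact hg (SchwartzMap.ext h)
  obtain ⟨C, hC, hgC⟩ := g.exists_norm_le_decayWeight 0
  have hc : Continuous fun y => ‖g y‖ ^ 2 := by fun_prop
  refine integral_pos_of_integrable_nonneg_nonzero (x := y) hc ?_ (fun y => by positivity)
    (by simpa using hy)
  refine ((g.integrable (μ := volume)).norm.const_mul C).mono' hc.aestronglyMeasurable
    (Eventually.of_forall fun y => ?_)
  rw [Real.norm_of_nonneg (by positivity), sq]
  gcongr
  simpa [decayWeight] using hgC y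

/-- The short-time Fourier transforms of a distribution for two windows are related by a
reproducing formula. -/
theorem stft_eq_integral (g f : 𝓢(V, ℂ)) (u : 𝓢'(V, ℂ)) (x ω : V) :
    ((∫ y, ‖g y‖ ^ 2 : ℝ) : ℂ) * stft f u x ω =
      ∫ w : V × V, (starRingEnd ℂ) (stft g (tfShift x ω f : 𝓢'(V, ℂ)) w.1 w.2) *
        stft g u w.1 w.2 := by
  set ψ := tfShift x ω f
  let F : V × V → 𝓢(V, ℂ) := fun w =>
    (starRingEnd ℂ) (stft g (ψ : 𝓢'(V, ℂ)) w.1 w.2) • schwartzConj (tfShift w.1 w.2 g)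
  have hT : Continuous fun w : V × V => schwartzConj (tfShift w.1 w.2 g) := by
    simp only [schwartzConj_tfShift]
    exact (continuous_tfShift (schwartzConj g)).comp (continuous_fst.prodMk continuous_snd.neg)
  have hFc : Continuous F :=
    (Complex.continuous_conj.comp (continuous_stft g (ψ : 𝓢'(V, ℂ)))).smul hT
  have hF : IsSchwartzIntegrable volume F := by
    refine ⟨hFc, fun k n => ?_⟩
    obtain ⟨C, M, hC, hM⟩ := polynomiallyBounded_tfShift (schwartzConj g) k n
    -- The extra `M` orders of decay offset the growth of the seminorms of the shifts, and the
    -- remaining `finrank + 1` orders give integrability.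
    obtain ⟨C', hC', hs⟩ := exists_norm_stft_schwartz_le g ψ (M + (Module.finrank ℝ V + 1))
    refine Integrable.mono' ((integrable_decayWeight_prod (V := V)
      (Nat.lt_succ_self _)).const_mul (C' * C))
      (((schwartz_withSeminorms ℂ V ℂ).continuous_seminorm (k, n)).comp hFc).aestronglyMeasurable
      (Eventually.of_forall fun w => ?_)
    rw [Real.norm_of_nonneg (apply_nonneg _ _)]
    simp only [F, map_smul_eq_mul, RCLike.norm_conj, schwartzConj_tfShift]
    have h1 := hM (w.1, -w.2)
    have h2 : ‖(w.1, -w.2)‖ = ‖w‖ := by simp [Prod.norm_def]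
    rw [h2] at h1
    have h3 : (1 + ‖w‖) ^ M ≤ (1 + ‖w.1‖) ^ M * (1 + ‖w.2‖) ^ M := by
      rw [← mul_pow]
      gcongr
      rw [Prod.norm_def]
      rcases max_cases ‖w.1‖ ‖w.2‖ with h | h <;> rw [h.1] <;>
        nlinarith [norm_nonneg w.1, norm_nonneg w.2]
    have hp := fun z : V => (decayWeight_pos (M + (Module.finrank ℝ V + 1)) z).le
    calc _ ≤ (C' * (decayWeight (M + (Module.finrank ℝ V + 1)) w.1 *
            decayWeight (M + (Module.finrank ℝ V + 1)) w.2)) *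
          (C * ((1 + ‖w.1‖) ^ M * (1 + ‖w.2‖) ^ M)) :=
          mul_le_mul (hs _ _) (h1.trans (mul_le_mul_of_nonneg_left h3 hC)) (apply_nonneg _ _)
            (mul_nonneg hC' (mul_nonneg (hp _) (hp _)))
      _ = C' * C * (((1 + ‖w.1‖) ^ M * decayWeight (M + (Module.finrank ℝ V + 1)) w.1) *
          ((1 + ‖w.2‖) ^ M * decayWeight (M + (Module.finrank ℝ V + 1)) w.2)) := by ring
      _ = _ := by rw [pow_mul_decayWeight_add, pow_mul_decayWeight_add]
  -- This is the conjugate of the inversion formula for `ψ`. Applying `u` to it gives the claim,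
  -- because `stft f u x ω` is `u (schwartzConj ψ)`.
  have hφ : ∀ y, (((∫ y, ‖g y‖ ^ 2 : ℝ) : ℂ) • schwartzConj ψ) y = ∫ w, F w y := by
    intro y
    have h1 := congrArg (starRingEnd ℂ) (integral_stft_mul_tfShift g ψ y)
    rw [← integral_conj, map_mul, Complex.conj_ofReal] at h1
    change ((∫ y, ‖g y‖ ^ 2 : ℝ) : ℂ) * (starRingEnd ℂ) (ψ y) = _
    rw [← h1]
    refine integral_congr_ae (Eventually.of_forall fun w => ?_)
    simp only [map_mul]
    rfl
  have key := TemperedDistribution.apply_eq_integral hF hφ u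
  simp only [F, map_smul, smul_eq_mul] at key
  exact key

theorem exists_enorm_stft_le {g : 𝓢(V, ℂ)} (hg : g ≠ 0) (f : 𝓢(V, ℂ)) (N : ℕ) :
    ∃ C : ℝ≥0, ∀ (u : 𝓢'(V, ℂ)) (x ω : V),
      ‖stft f u x ω‖ₑ ≤ C * ∫⁻ w : V × V, ENNReal.ofReal (decayWeight N (x - w.1)) *
        ENNReal.ofReal (decayWeight N (ω - w.2)) * ‖stft g u w.1 w.2‖ₑ := by
  have hI := SchwartzMap.integral_norm_sq_pos hg
  obtain ⟨C, hC, h⟩ := exists_norm_stft_tfShift_le g f N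
  refine ⟨Real.toNNReal ((∫ y, ‖g y‖ ^ 2)⁻¹ * C), fun u x ω => ?_⟩
  have h1 : stft f u x ω = (((∫ y, ‖g y‖ ^ 2 : ℝ)⁻¹ : ℝ) : ℂ) *
      ∫ w : V × V, (starRingEnd ℂ) (stft g (tfShift x ω f : 𝓢'(V, ℂ)) w.1 w.2) *
        stft g u w.1 w.2 := by
    rw [← stft_eq_integral, ← mul_assoc, ← Complex.ofReal_mul, inv_mul_cancel₀ hI.ne',
      Complex.ofReal_one, one_mul]
  rw [h1, enorm_mul, ← lintegral_const_mul' _ _ ENNReal.coe_ne_top]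
  refine (mul_le_mul_right (enorm_integral_le_lintegral_enorm _) _).trans ?_
  rw [← lintegral_const_mul' _ _ enorm_ne_top]
  refine lintegral_mono fun w => ?_
  rw [enorm_mul, ← mul_assoc, ← mul_assoc]
  refine mul_le_mul_left ?_ _
  rw [← enorm_mul, ← ofReal_norm, norm_mul, RCLike.norm_conj, Complex.norm_real,
    Real.norm_of_nonneg (inv_nonneg.2 hI.le)]
  change _ ≤ ENNReal.ofReal _ * _
  rw [← ENNReal.ofReal_mul (decayWeight_pos _ _).le,
    ← ENNReal.ofReal_mul (mul_nonneg (inv_nonneg.2 hI.le) hC), mul_assoc]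
  exact ENNReal.ofReal_le_ofReal (mul_le_mul_of_nonneg_left (h x ω w.1 w.2)
    (inv_nonneg.2 hI.le))

end ReproducingFormula

/-! ### Minkowski and Young inequalities in mixed norms, and embeddings of modulation spaces. -/

section MixedNormInequalities

open Filter Topology

section Minkowski

variable {α β : Type*} [MeasurableSpace α] [MeasurableSpace β] {μ : Measure α} {ν : Measure β}

/-- Hölder applied to the splitting `w f = w^{1 - 1/r} (w f^r)^{1/r}`. -/
theorem ENNReal.lintegral_weight_mul_rpow_le {w f : α → ℝ≥0∞} (hw : Measurable w)
    (hf : Measurable f) (hw' : ∀ x, w x ≠ ∞) {r : ℝ} (hr : 1 ≤ r) :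
    (∫⁻ x, w x * f x ∂μ) ^ r ≤ (∫⁻ x, w x ∂μ) ^ (r - 1) * ∫⁻ x, w x * f x ^ r ∂μ := by
  have hr0 : 0 < r := by linarith
  have h := ENNReal.lintegral_mul_norm_pow_le (μ := μ) (p := 1 - r⁻¹) (q := r⁻¹)
    hw.aemeasurable (hw.mul (hf.pow_const r)).aemeasurable
    (sub_nonneg.2 (inv_le_one_of_one_le₀ hr)) (inv_nonneg.2 hr0.le) (by ring)
  have h1 : ∀ x, w x ^ (1 - r⁻¹) * (w x * f x ^ r) ^ r⁻¹ = w x * f x := by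
    intro x
    rw [ENNReal.mul_rpow_of_nonneg _ _ (inv_nonneg.2 hr0.le), ← ENNReal.rpow_mul,
      mul_inv_cancel₀ hr0.ne', ENNReal.rpow_one, ← mul_assoc,
      ← ENNReal.rpow_add_of_nonneg _ _ (sub_nonneg.2 (inv_le_one_of_one_le₀ hr))
        (inv_nonneg.2 hr0.le)]
    simp
  simp only [Pi.mul_apply, h1] at h
  refine (ENNReal.rpow_le_rpow h hr0.le).trans_eq ?_
  rw [ENNReal.mul_rpow_of_nonneg _ _ hr0.le, ← ENNReal.rpow_mul, ← ENNReal.rpow_mul,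
    inv_mul_cancel₀ hr0.ne', ENNReal.rpow_one]
  congr 2
  field_simp

/-- With `I` the integral of `φ^p`, writing `φ^p = φ · φ^{p-1}` and using Hölder in `a` gives `I ≤ S
· I^{1/q}`. Dividing by `I^{1/q}` needs `I` finite, which is why the statement concerns a minorant
`φ` of the integral. -/
theorem ENNReal.rpow_lintegral_le_of_le_lintegral [SFinite μ] [SFinite ν] {p : ℝ} (hp : 1 < p)
    {F : α → β → ℝ≥0∞} (hF : Measurable (Function.uncurry F)) {φ : α → ℝ≥0∞}
    (hφ : Measurable φ) (hφF : ∀ a, φ a ≤ ∫⁻ b, F a b ∂ν) (hφi : ∫⁻ a, φ a ^ p ∂μ ≠ ∞) :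
    (∫⁻ a, φ a ^ p ∂μ) ^ (1 / p) ≤ ∫⁻ b, (∫⁻ a, F a b ^ p ∂μ) ^ (1 / p) ∂ν := by
  have hp0 : 0 < p := by linarith
  set q := p.conjExponent
  have hpq : p.HolderConjugate q := Real.HolderConjugate.conjExponent hp
  set I := ∫⁻ a, φ a ^ p ∂μ
  set S := ∫⁻ b, (∫⁻ a, F a b ^ p ∂μ) ^ (1 / p) ∂ν
  have h1 : I ≤ S * I ^ (1 / q) := by
    calc I ≤ ∫⁻ a, ∫⁻ b, F a b * φ a ^ (p - 1) ∂ν ∂μ := by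
          refine lintegral_mono fun a => ?_
          rw [lintegral_mul_const _ hF.of_uncurry_left]
          have : φ a ^ p = φ a * φ a ^ (p - 1) := by
            nth_rewrite 2 [← ENNReal.rpow_one (φ a)]
            rw [← ENNReal.rpow_add_of_nonneg _ _ zero_le_one (by linarith)]
            congr 1
            ring
          rw [this]
          exact mul_le_mul_left (hφF a) _
      _ = ∫⁻ b, ∫⁻ a, F a b * φ a ^ (p - 1) ∂μ ∂ν :=
          lintegral_lintegral_swap
            (hF.mul ((hφ.comp measurable_fst).pow_const _)).aemeasurable
      _ ≤ ∫⁻ b, (∫⁻ a, F a b ^ p ∂μ) ^ (1 / p) * I ^ (1 / q) ∂ν := by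
          refine lintegral_mono fun b => ?_
          refine (ENNReal.lintegral_mul_le_Lp_mul_Lq μ hpq hF.of_uncurry_right.aemeasurable
            (hφ.pow_const (p - 1)).aemeasurable).trans_eq ?_
          congr 2
          refine lintegral_congr fun a => ?_
          rw [← ENNReal.rpow_mul, hpq.sub_one_mul_conj]
      _ = S * I ^ (1 / q) := by
          rw [lintegral_mul_const]
          exact (Measurable.lintegral_prod_left' (f := fun z : α × β => F z.1 z.2 ^ p)
            (hF.pow_const p)).pow_const _
  rcases eq_or_ne I 0 with h0 | h0
  · rw [h0, ENNReal.zero_rpow_of_pos (by positivity)]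
    exact zero_le
  · have h2 : I = I ^ (1 / p) * I ^ (1 / q) := by
      rw [← ENNReal.rpow_add _ _ h0 hφi, one_div, one_div, hpq.inv_add_inv_eq_one,
        ENNReal.rpow_one]
    nth_rewrite 1 [h2] at h1
    refine (ENNReal.mul_le_mul_iff_left (c := I ^ (1 / q)) ?_ ?_).1 h1
    · exact (ENNReal.rpow_pos (pos_iff_ne_zero.2 h0) hφi).ne'
    · exact ENNReal.rpow_ne_top_of_nonneg (by have := hpq.symm.pos; positivity) hφi

/-- Minkowski's integral inequality. -/
theorem ENNReal.lintegral_rpow_lintegral_le [SigmaFinite μ] [SFinite ν] {p : ℝ} (hp : 1 ≤ p)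
    {F : α → β → ℝ≥0∞} (hF : Measurable (Function.uncurry F)) :
    (∫⁻ a, (∫⁻ b, F a b ∂ν) ^ p ∂μ) ^ (1 / p) ≤ ∫⁻ b, (∫⁻ a, F a b ^ p ∂μ) ^ (1 / p) ∂ν := by
  rcases hp.eq_or_lt with rfl | hp
  · simp only [ENNReal.rpow_one, one_div, inv_one]
    exact (lintegral_lintegral_swap hF.aemeasurable).le
  have hp0 : 0 < p := by linarith
  set h : α → ℝ≥0∞ := fun a => ∫⁻ b, F a b ∂ν
  have hh : Measurable h := hF.lintegral_prod_right'
  set S := ∫⁻ b, (∫⁻ a, F a b ^ p ∂μ) ^ (1 / p) ∂ν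
  -- The truncations are bounded and live on sets of finite measure, so their `p`-th powers are
  -- integrable. Fatou's lemma then removes the truncation.
  let φ : ℕ → α → ℝ≥0∞ := fun n => (spanningSets μ n).indicator fun a => min (h a) n
  have hφm : ∀ n, Measurable (φ n) := fun n =>
    (hh.min measurable_const).indicator (measurableSet_spanningSets μ n)
  have hφp : ∀ n, ∫⁻ a, φ n a ^ p ∂μ ≤ S ^ p := by
    intro n
    have h1 : ∫⁻ a, φ n a ^ p ∂μ ≠ ∞ := by
      refine ne_top_of_le_ne_top (b := (n : ℝ≥0∞) ^ p * μ (spanningSets μ n)) ?_ ?_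
      · exact ENNReal.mul_ne_top (ENNReal.rpow_ne_top_of_nonneg hp0.le (ENNReal.natCast_ne_top n))
          (measure_spanningSets_lt_top μ n).ne
      · rw [← lintegral_indicator_const (measurableSet_spanningSets μ n)]
        refine lintegral_mono fun a => ?_
        by_cases ha : a ∈ spanningSets μ n
        · simp only [φ, Set.indicator_of_mem ha]
          exact ENNReal.rpow_le_rpow (min_le_right _ _) hp0.le
        · simp [φ, Set.indicator_of_notMem ha, hp0]
    have h2 := ENNReal.rpow_lintegral_le_of_le_lintegral (ν := ν) hp hF (hφm n) (fun a => ?_) h1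
    · have h3 := ENNReal.rpow_le_rpow h2 hp0.le
      rwa [← ENNReal.rpow_mul, one_div, inv_mul_cancel₀ hp0.ne', ENNReal.rpow_one, ← one_div] at h3
    · by_cases ha : a ∈ spanningSets μ n
      · simp only [φ, Set.indicator_of_mem ha]
        exact min_le_left _ _
      · simp [φ, Set.indicator_of_notMem ha]
  have hlim : ∀ a, Tendsto (fun n => φ n a ^ p) atTop (𝓝 (h a ^ p)) := by
    intro a
    refine (ENNReal.continuous_rpow_const.tendsto _).comp ?_
    have h1 : Tendsto (fun n : ℕ => min (h a) n) atTop (𝓝 (h a)) := by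
      simpa using (tendsto_const_nhds (x := h a)).min ENNReal.tendsto_nat_nhds_top
    refine h1.congr' ?_
    filter_upwards [eventually_ge_atTop (spanningSetsIndex μ a)] with n hn
    simp only [φ, Set.indicator_of_mem (monotone_spanningSets μ hn (mem_spanningSetsIndex μ a))]
  have hle : ∫⁻ a, h a ^ p ∂μ ≤ S ^ p := by
    calc ∫⁻ a, h a ^ p ∂μ = ∫⁻ a, liminf (fun n => φ n a ^ p) atTop ∂μ :=
          lintegral_congr fun a => (hlim a).liminf_eq.symm
      _ ≤ liminf (fun n => ∫⁻ a, φ n a ^ p ∂μ) atTop :=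
          lintegral_liminf_le fun n => (hφm n).pow_const p
      _ ≤ S ^ p := liminf_le_of_le (by isBoundedDefault) fun b hb => by
          obtain ⟨n, hn⟩ := hb.exists
          exact hn.trans (hφp n)
  refine (ENNReal.rpow_le_rpow hle (by positivity)).trans_eq ?_
  rw [← ENNReal.rpow_mul, mul_one_div_cancel hp0.ne', ENNReal.rpow_one]

end Minkowski

theorem eLpNorm_ennreal_eq_lintegral {α : Type*} [MeasurableSpace α] {μ : Measure α}
    {p : ℝ≥0∞} (hp : p ≠ 0) (hp' : p ≠ ∞) (f : α → ℝ≥0∞) :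
    eLpNorm f p μ = (∫⁻ a, f a ^ p.toReal ∂μ) ^ (1 / p.toReal) := by
  rw [eLpNorm_eq_lintegral_rpow_enorm_toReal hp hp']
  rfl

theorem eLpNorm_ennreal_const_mul {α : Type*} [MeasurableSpace α] {μ : Measure α} (c : ℝ≥0∞)
    {f : α → ℝ≥0∞} (hf : Measurable f) (p : ℝ≥0∞) :
    eLpNorm (fun a => c * f a) p μ = c * eLpNorm f p μ := by
  rcases eq_or_ne p 0 with rfl | hp
  · simp
  rcases eq_or_ne p ∞ with rfl | hp'
  · simp only [eLpNorm_exponent_top, eLpNormEssSup, enorm_eq_self]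
    exact ENNReal.essSup_const_mul
  · have h0 : 0 < p.toReal := ENNReal.toReal_pos hp hp'
    rw [eLpNorm_ennreal_eq_lintegral hp hp', eLpNorm_ennreal_eq_lintegral hp hp']
    simp only [ENNReal.mul_rpow_of_nonneg _ _ h0.le]
    rw [lintegral_const_mul _ (hf.pow_const _), ENNReal.mul_rpow_of_nonneg _ _ (by positivity),
      ← ENNReal.rpow_mul, mul_one_div_cancel h0.ne', ENNReal.rpow_one]

theorem ENNReal.one_le_toReal {p : ℝ≥0∞} (hp : 1 ≤ p) (hp' : p ≠ ∞) : 1 ≤ p.toReal := by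
  rwa [← ENNReal.toReal_one, ENNReal.toReal_le_toReal ENNReal.one_ne_top hp']

section Convolution

variable {V : Type*} [NormedAddCommGroup V] [InnerProductSpace ℝ V] [FiniteDimensional ℝ V]
  [MeasurableSpace V] [BorelSpace V]

theorem lintegral_sub_mul_rpow_le {k f : V → ℝ≥0∞} (hk : Measurable k) (hk1 : ∀ x, k x ≤ 1)
    (hf : Measurable f) {r : ℝ} (hr : 1 ≤ r) (x : V) :
    (∫⁻ y, k (x - y) * f y) ^ r ≤ (∫⁻ y, k y) ^ (r - 1) * ∫⁻ y, k (x - y) * f y ^ r := by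
  rw [← lintegral_sub_left_eq_self k x]
  exact ENNReal.lintegral_weight_mul_rpow_le (hk.comp (measurable_const.sub measurable_id)) hf
    (fun y => ((hk1 (x - y)).trans_lt ENNReal.one_lt_top).ne) hr

/-- The endpoint from `L^r` to `L^∞` of Young's inequality. Replacing `∫ k` by its maximum with 1
lets every smaller power of it be absorbed in the first power, uniformly in `r`. -/
theorem lintegral_sub_mul_le_eLpNorm {k f : V → ℝ≥0∞} (hk : Measurable k) (hk1 : ∀ x, k x ≤ 1)
    (hf : Measurable f) {r : ℝ≥0∞} (hr : 1 ≤ r) (x : V) :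
    ∫⁻ y, k (x - y) * f y ≤ max (∫⁻ y, k y) 1 * eLpNorm f r volume := by
  rcases eq_or_ne r ∞ with rfl | hr'
  · calc ∫⁻ y, k (x - y) * f y ≤ ∫⁻ y, k (x - y) * eLpNorm f ∞ volume := by
          refine lintegral_mono_ae ?_
          filter_upwards [enorm_ae_le_eLpNormEssSup f volume] with y hy
          rw [eLpNorm_exponent_top]
          exact mul_le_mul_right hy _
      _ = (∫⁻ y, k y) * eLpNorm f ∞ volume := by
          rw [lintegral_mul_const _ (by fun_prop),
            lintegral_sub_left_eq_self k x]
      _ ≤ _ := mul_le_mul_left (le_max_left _ _) _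
  · have h1 := ENNReal.one_le_toReal hr hr'
    have h0 : 0 < r.toReal := by linarith
    rw [eLpNorm_ennreal_eq_lintegral (by positivity) hr']
    refine (ENNReal.rpow_le_rpow_iff h0).1 ?_
    rw [ENNReal.mul_rpow_of_nonneg _ _ h0.le, ← ENNReal.rpow_mul, one_div,
      inv_mul_cancel₀ h0.ne', ENNReal.rpow_one]
    refine (lintegral_sub_mul_rpow_le hk hk1 hf h1 x).trans (mul_le_mul' ?_ ?_)
    · refine (ENNReal.rpow_le_rpow (le_max_left _ 1) (by linarith)).trans ?_
      exact ENNReal.rpow_le_rpow_of_exponent_le (le_max_right _ _) (by linarith)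
    · exact lintegral_mono fun y => mul_le_of_le_one_left zero_le (hk1 _)

/-- A Young type inequality for convolution with a bounded integrable kernel. -/
theorem eLpNorm_lintegral_sub_mul_le {k f : V → ℝ≥0∞} (hk : Measurable k) (hk1 : ∀ x, k x ≤ 1)
    (hf : Measurable f) {r t : ℝ≥0∞} (hr : 1 ≤ r) (hrt : r ≤ t) :
    eLpNorm (fun x => ∫⁻ y, k (x - y) * f y) t volume ≤
      max (∫⁻ y, k y) 1 * eLpNorm f r volume := by
  rcases eq_or_ne t ∞ with rfl | ht'
  · rw [eLpNorm_exponent_top]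
    exact essSup_le_of_ae_le _ (Eventually.of_forall fun x =>
      lintegral_sub_mul_le_eLpNorm hk hk1 hf hr x)
  have hr' : r ≠ ∞ := ne_top_of_le_ne_top ht' hrt
  have h1 := ENNReal.one_le_toReal hr hr'
  have hrt' : r.toReal ≤ t.toReal := ENNReal.toReal_mono ht' hrt
  have h0 : 0 < r.toReal := by linarith
  have ht0 : 0 < t.toReal := by linarith
  have ht1 : t ≠ 0 := (zero_lt_one.trans_le (hr.trans hrt)).ne'
  set κ := max (∫⁻ y, k y) 1
  set A := eLpNorm f r volume
  have hA : ∫⁻ y, f y ^ r.toReal = A ^ r.toReal := by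
    simp only [A]
    rw [eLpNorm_ennreal_eq_lintegral (by positivity) hr', ← ENNReal.rpow_mul, one_div,
      inv_mul_cancel₀ h0.ne', ENNReal.rpow_one]
  rw [eLpNorm_ennreal_eq_lintegral ht1 ht']
  refine (ENNReal.rpow_le_rpow_iff ht0).1 ?_
  rw [← ENNReal.rpow_mul, one_div, inv_mul_cancel₀ ht0.ne', ENNReal.rpow_one]
  have hmeas : Measurable fun z : V × V => k (z.1 - z.2) * f z.2 ^ r.toReal :=
    (hk.comp (measurable_fst.sub measurable_snd)).mul ((hf.comp measurable_snd).pow_const _)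
  -- Of the `t` powers, `t - r` are bounded by the `L^∞` endpoint and the remaining `r` by Jensen's
  -- inequality, whose right side integrates in `x` by Tonelli.
  calc ∫⁻ x, (∫⁻ y, k (x - y) * f y) ^ t.toReal
      ≤ ∫⁻ x, (κ * A) ^ (t.toReal - r.toReal) *
          (κ ^ (r.toReal - 1) * ∫⁻ y, k (x - y) * f y ^ r.toReal) := by
        refine lintegral_mono fun x => ?_
        have h2 : t.toReal = (t.toReal - r.toReal) + r.toReal := by ring
        nth_rewrite 1 [h2]
        rw [ENNReal.rpow_add_of_nonneg _ _ (by linarith) h0.le]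
        refine mul_le_mul' (ENNReal.rpow_le_rpow (lintegral_sub_mul_le_eLpNorm hk hk1 hf hr x)
          (by linarith)) ((lintegral_sub_mul_rpow_le hk hk1 hf h1 x).trans ?_)
        exact mul_le_mul_left (ENNReal.rpow_le_rpow (le_max_left _ _) (by linarith)) _
    _ = (κ * A) ^ (t.toReal - r.toReal) * (κ ^ (r.toReal - 1) *
          ((∫⁻ y, k y) * A ^ r.toReal)) := by
        have h3 : Measurable fun x => ∫⁻ y, k (x - y) * f y ^ r.toReal :=
          hmeas.lintegral_prod_right'
        rw [lintegral_const_mul _ (h3.const_mul _), lintegral_const_mul _ h3,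
          lintegral_lintegral_swap hmeas.aemeasurable, ← hA,
          ← lintegral_const_mul _ (hf.pow_const _)]
        congr 2
        refine lintegral_congr fun y => ?_
        rw [lintegral_mul_const _ (by fun_prop)]
        congr 1
        exact lintegral_sub_right_eq_self k y
    _ ≤ (κ * A) ^ (t.toReal - r.toReal) * (κ * A) ^ r.toReal := by
        refine mul_le_mul_right ?_ _
        rw [ENNReal.mul_rpow_of_nonneg _ _ h0.le, ← mul_assoc]
        refine mul_le_mul_left ?_ _
        refine (mul_le_mul_right (le_max_left _ 1) _).trans_eq ?_
        change κ ^ (r.toReal - 1) * κ = _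
        nth_rewrite 2 [← ENNReal.rpow_one κ]
        rw [← ENNReal.rpow_add_of_nonneg _ _ (by linarith) zero_le_one]
        congr 1
        ring
    _ = (κ * A) ^ t.toReal := by
        rw [← ENNReal.rpow_add_of_nonneg _ _ (by linarith) h0.le]
        congr 1
        ring

/-- The set where `f` is at most its essential supremum is closed and of full measure, hence dense,
hence everything. -/
theorem essSup_eq_iSup_of_continuous {X : Type*} [TopologicalSpace X] [MeasurableSpace X]
    {μ : Measure X} [μ.IsOpenPosMeasure] {f : X → ℝ≥0∞} (hf : Continuous f) :
    essSup f μ = ⨆ x, f x := by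
  refine le_antisymm (essSup_le_of_ae_le _ (Eventually.of_forall fun x => le_iSup f x))
    (iSup_le fun x => ?_)
  have h1 : Dense {x | f x ≤ essSup f μ} := Measure.dense_of_ae (ENNReal.ae_le_essSup f)
  exact (isClosed_le hf continuous_const).closure_subset (h1 x)

theorem measurable_eLpNorm_section {F : V × V → ℝ≥0∞} (hF : Continuous F) {p : ℝ≥0∞}
    (hp : p ≠ 0) : Measurable fun ω => eLpNorm (fun x => F (x, ω)) p volume := by
  rcases eq_or_ne p ∞ with rfl | hp'
  -- For `p = ∞` the essential supremum is a supremum of continuous functions of ω, hence lower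
  -- semicontinuous.
  · have h1 : ∀ ω, eLpNorm (fun x => F (x, ω)) ∞ volume = ⨆ x, F (x, ω) := fun ω => by
      rw [eLpNorm_exponent_top]
      exact essSup_eq_iSup_of_continuous (f := fun x => F (x, ω)) (by fun_prop)
    simp only [h1]
    exact (lowerSemicontinuous_iSup fun x =>
      (hF.comp (Continuous.prodMk_right x)).lowerSemicontinuous).measurable
  · simp only [eLpNorm_ennreal_eq_lintegral hp hp']
    exact (Measurable.lintegral_prod_left' (f := fun z : V × V => F z ^ p.toReal)
      (hF.measurable.pow_const _)).pow_const _

theorem measurable_eLpNorm_stft (g : 𝓢(V, ℂ)) (u : 𝓢'(V, ℂ)) {p : ℝ≥0∞} (hp : p ≠ 0) :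
    Measurable fun ω => eLpNorm (fun x => stft g u x ω) p volume := by
  have h := measurable_eLpNorm_section (F := fun z : V × V => ‖stft g u z.1 z.2‖ₑ)
    (continuous_stft g u).enorm hp
  simpa only [eLpNorm_enorm] using h

/-- A mixed norm Young type inequality. -/
theorem eLpNorm_eLpNorm_le_of_le_lintegral {k : V → ℝ≥0∞} (hk : Measurable k)
    (hk1 : ∀ x, k x ≤ 1) {F : V × V → ℝ≥0∞} (hF : Continuous F) {H : V → V → ℝ≥0∞} {C : ℝ≥0}
    (hH : ∀ x ω, H x ω ≤ C * ∫⁻ w : V × V, k (x - w.1) * k (ω - w.2) * F w)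
    {r₁ r₂ t₁ t₂ : ℝ≥0∞} (hr₁ : 1 ≤ r₁) (hr₂ : 1 ≤ r₂) (h₁ : r₁ ≤ t₁) (h₂ : r₂ ≤ t₂) :
    eLpNorm (fun ω => eLpNorm (fun x => H x ω) t₁ volume) t₂ volume ≤
      C * max (∫⁻ y, k y) 1 ^ 2 *
        eLpNorm (fun ω => eLpNorm (fun x => F (x, ω)) r₁ volume) r₂ volume := by
  set κ := max (∫⁻ y, k y) 1
  set N : V → ℝ≥0∞ := fun ω => eLpNorm (fun x => F (x, ω)) r₁ volume
  have hN : Measurable N := measurable_eLpNorm_section hF (zero_lt_one.trans_le hr₁).ne'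
  let G : V → V → ℝ≥0∞ := fun x ω' => ∫⁻ x', k (x - x') * F (x', ω')
  have hG : Measurable (Function.uncurry G) := by
    refine Measurable.lintegral_prod_right'
      (f := fun z : (V × V) × V => k (z.1.1 - z.2) * F (z.2, z.1.2)) ?_
    have := hF.measurable
    fun_prop
  have hH' : ∀ x ω, H x ω ≤ C * ∫⁻ ω', k (ω - ω') * G x ω' := by
    intro x ω
    refine (hH x ω).trans_eq ?_
    rw [Measure.volume_eq_prod, lintegral_prod_symm']
    · congr 1
      refine lintegral_congr fun ω' => ?_
      have := hF.measurable
      rw [← lintegral_const_mul _ (by fun_prop)]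
      refine lintegral_congr fun x' => ?_
      ring
    · have := hF.measurable
      fun_prop
  have hin : ∀ ω, eLpNorm (fun x => H x ω) t₁ volume ≤
      C * κ * ∫⁻ ω', k (ω - ω') * N ω' := by
    intro ω
    have hkω : Measurable fun ω' => k (ω - ω') := by fun_prop
    have hY : ∀ ω', eLpNorm (fun x => G x ω') t₁ volume ≤ κ * N ω' := fun ω' =>
      eLpNorm_lintegral_sub_mul_le hk hk1 (f := fun x' => F (x', ω'))
        (by have := hF.measurable; fun_prop) hr₁ h₁
    have hR : ∫⁻ ω', k (ω - ω') * (κ * N ω') = κ * ∫⁻ ω', k (ω - ω') * N ω' := by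
      rw [← lintegral_const_mul _ (by fun_prop)]
      exact lintegral_congr fun ω' => by ring
    -- Minkowski moves the norm in x inside the integral over `ω'`. At `t₁ = ∞` the pointwise
    -- endpoint of Young's inequality replaces it.
    rcases eq_or_ne t₁ ∞ with rfl | ht₁
    · rw [eLpNorm_exponent_top]
      refine essSup_le_of_ae_le _ (Eventually.of_forall fun x => ?_)
      refine (hH' x ω).trans ?_
      rw [mul_assoc, ← hR]
      refine mul_le_mul_right (lintegral_mono fun ω' => mul_le_mul_right ?_ _) _
      exact lintegral_sub_mul_le_eLpNorm hk hk1 (f := fun x' => F (x', ω'))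
        (by have := hF.measurable; fun_prop) hr₁ x
    · have ht1 := ENNReal.one_le_toReal (hr₁.trans h₁) ht₁
      have ht0 : t₁ ≠ 0 := (zero_lt_one.trans_le (hr₁.trans h₁)).ne'
      have h0 : 0 < t₁.toReal := by linarith
      have hm : Measurable (Function.uncurry fun x ω' => k (ω - ω') * G x ω') :=
        (hkω.comp measurable_snd).mul hG
      calc eLpNorm (fun x => H x ω) t₁ volume
          ≤ eLpNorm (fun x => C * ∫⁻ ω', k (ω - ω') * G x ω') t₁ volume :=
            eLpNorm_mono_enorm fun x => hH' x ω
        _ = C * eLpNorm (fun x => ∫⁻ ω', k (ω - ω') * G x ω') t₁ volume :=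
            eLpNorm_ennreal_const_mul _ hm.lintegral_prod_right' _
        _ ≤ C * ∫⁻ ω', eLpNorm (fun x => k (ω - ω') * G x ω') t₁ volume := by
            refine mul_le_mul_right ?_ _
            simp only [eLpNorm_ennreal_eq_lintegral ht0 ht₁]
            exact ENNReal.lintegral_rpow_lintegral_le ht1 hm
        _ ≤ C * ∫⁻ ω', k (ω - ω') * (κ * N ω') := by
            refine mul_le_mul_right (lintegral_mono fun ω' => ?_) _
            rw [eLpNorm_ennreal_const_mul _ hG.of_uncurry_right]
            exact mul_le_mul_right (hY ω') _
        _ = _ := by rw [hR, mul_assoc]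
  calc eLpNorm (fun ω => eLpNorm (fun x => H x ω) t₁ volume) t₂ volume
      ≤ eLpNorm (fun ω => ∫⁻ ω', k (ω - ω') * (C * κ * N ω')) t₂ volume := by
        refine eLpNorm_mono_enorm fun ω => (hin ω).trans_eq ?_
        rw [← lintegral_const_mul _ (by fun_prop)]
        exact lintegral_congr fun ω' => by ring
    _ ≤ κ * eLpNorm (fun ω => C * κ * N ω) r₂ volume :=
        eLpNorm_lintegral_sub_mul_le hk hk1 (by fun_prop) hr₂ h₂
    _ = κ * (C * κ * eLpNorm N r₂ volume) := by rw [eLpNorm_ennreal_const_mul _ hN]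
    _ = _ := by ring

/-- Continuous inclusions of modulation spaces, and independence of the window. -/
theorem exists_modNorm_le {g : 𝓢(V, ℂ)} (hg : g ≠ 0) (f : 𝓢(V, ℂ)) {r₁ r₂ t₁ t₂ : ℝ≥0∞}
    (hr₁ : 1 ≤ r₁) (hr₂ : 1 ≤ r₂) (h₁ : r₁ ≤ t₁) (h₂ : r₂ ≤ t₂) :
    ∃ C : ℝ≥0, ∀ u : 𝓢'(V, ℂ), modNorm f t₁ t₂ u ≤ C * modNorm g r₁ r₂ u := by
  -- The least integer order of decay that makes the kernel integrable.
  set N := Module.finrank ℝ V + 1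
  obtain ⟨C, hC⟩ := exists_enorm_stft_le hg f N
  let k : V → ℝ≥0∞ := fun x => ENNReal.ofReal (decayWeight N x)
  have hk : Measurable k := (continuous_decayWeight N).measurable.ennreal_ofReal
  have hk1 : ∀ x, k x ≤ 1 := fun x => ENNReal.ofReal_le_one.2 (decayWeight_le_one N x)
  have hki : max (∫⁻ y, k y) 1 ≠ ∞ := by
    refine (max_lt ?_ ENNReal.one_lt_top).ne
    exact (integrable_decayWeight (V := V) (Nat.lt_succ_self _)).lintegral_lt_top
  refine ⟨C * (max (∫⁻ y, k y) 1).toNNReal ^ 2, fun u => ?_⟩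
  have h := eLpNorm_eLpNorm_le_of_le_lintegral hk hk1
    (F := fun z : V × V => ‖stft g u z.1 z.2‖ₑ) (continuous_stft g u).enorm
    (H := fun x ω => ‖stft f u x ω‖ₑ) (hC u) hr₁ hr₂ h₁ h₂
  simp only [eLpNorm_enorm] at h
  rw [ENNReal.coe_mul, ENNReal.coe_pow, ENNReal.coe_toNNReal hki]
  exact h

end Convolution

end MixedNormInequalities

/-! ### Sufficiency: the Schrödinger multiplier on modulation spaces. -/

section Boundedness

open Filter Topology

variable {V : Type*} [NormedAddCommGroup V] [InnerProductSpace ℝ V] [FiniteDimensional ℝ V]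
  [MeasurableSpace V] [BorelSpace V]

section ModulationSpace

theorem modNorm_add_le (g : 𝓢(V, ℂ)) {p q : ℝ≥0∞} (hp : 1 ≤ p) (hq : 1 ≤ q) (u v : 𝓢'(V, ℂ)) :
    modNorm g p q (u + v) ≤ modNorm g p q u + modNorm g p q v := by
  have hp0 : p ≠ 0 := (zero_lt_one.trans_le hp).ne'
  have hc := fun (u : 𝓢'(V, ℂ)) (ω : V) => ((continuous_stft g u).comp
    (Continuous.prodMk_left ω)).aestronglyMeasurable (μ := (volume : Measure V))
  refine le_trans (eLpNorm_mono_enorm fun ω => ?_) (eLpNorm_add_le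
    (measurable_eLpNorm_stft g u hp0).aestronglyMeasurable
    (measurable_eLpNorm_stft g v hp0).aestronglyMeasurable hq)
  exact eLpNorm_add_le (hc u ω) (hc v ω) hp

theorem modNorm_smul (g : 𝓢(V, ℂ)) {p : ℝ≥0∞} (hp : 1 ≤ p) (q : ℝ≥0∞) (c : ℂ) (u : 𝓢'(V, ℂ)) :
    modNorm g p q (c • u) = ‖c‖ₑ * modNorm g p q u := by
  have hp0 : p ≠ 0 := (zero_lt_one.trans_le hp).ne'
  have h1 : ∀ ω, eLpNorm (fun x => stft g (c • u) x ω) p volume =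
      ‖c‖ₑ * eLpNorm (fun x => stft g u x ω) p volume := fun ω =>
    eLpNorm_const_smul c (fun x => stft g u x ω) p volume
  simp only [modNorm, h1]
  exact eLpNorm_ennreal_const_mul _ (measurable_eLpNorm_stft g u hp0) q

theorem modNorm_zero (g : 𝓢(V, ℂ)) (p q : ℝ≥0∞) : modNorm g p q (0 : 𝓢'(V, ℂ)) = 0 := by
  have h : ∀ x ω, stft g (0 : 𝓢'(V, ℂ)) x ω = 0 := fun _ _ => rfl
  simp [modNorm, h]

/-- The closure of the Schwartz space in a modulation space, as a linear subspace. -/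
noncomputable def modSpaceClosureSubmodule (g : 𝓢(V, ℂ)) {p q : ℝ≥0∞} (hp : 1 ≤ p) (hq : 1 ≤ q) :
    Submodule ℂ 𝓢'(V, ℂ) where
  carrier := modSpaceClosure g p q
  add_mem' := by
    rintro u v ⟨hu, hu'⟩ ⟨hv, hv'⟩
    refine ⟨(modNorm_add_le g hp hq u v).trans_lt (ENNReal.add_lt_top.2 ⟨hu, hv⟩), fun ε hε => ?_⟩
    obtain ⟨f₁, hf₁⟩ := hu' (ε / 2) (ENNReal.half_pos hε.ne')
    obtain ⟨f₂, hf₂⟩ := hv' (ε / 2) (ENNReal.half_pos hε.ne')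
    refine ⟨f₁ + f₂, ?_⟩
    rw [map_add, add_sub_add_comm, ← ENNReal.add_halves ε]
    exact (modNorm_add_le g hp hq _ _).trans_lt (ENNReal.add_lt_add hf₁ hf₂)
  zero_mem' := by
    refine ⟨?_, fun ε hε => ⟨0, ?_⟩⟩
    · change modNorm g p q 0 < ∞
      rw [modNorm_zero g]
      exact ENNReal.zero_lt_top
    · rwa [map_zero, sub_zero, modNorm_zero g]
  smul_mem' := by
    rintro c u ⟨hu, hu'⟩
    refine ⟨?_, fun ε hε => ?_⟩
    · change modNorm g p q (c • u) < ∞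
      rw [modNorm_smul g hp]
      exact ENNReal.mul_lt_top enorm_lt_top hu
    -- Adding 1 avoids dividing by zero when `c = 0`.
    · obtain ⟨f, hf⟩ := hu' (ε / (‖c‖ₑ + 1))
        (ENNReal.div_pos hε.ne' (ENNReal.add_ne_top.2 ⟨enorm_ne_top, ENNReal.one_ne_top⟩))
      refine ⟨c • f, ?_⟩
      rw [map_smul, ← smul_sub, modNorm_smul g hp]
      refine lt_of_le_of_lt (mul_le_mul_left (le_add_right le_rfl : ‖c‖ₑ ≤ ‖c‖ₑ + 1) _) ?_
      rw [mul_comm]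
      exact ENNReal.mul_lt_of_lt_div hf

/-- By the embeddings it suffices to treat `M^{1,1}`, where the decay of the transform makes the
double integral finite. -/
theorem modNorm_schwartz_lt_top {g : 𝓢(V, ℂ)} (hg : g ≠ 0) {p q : ℝ≥0∞} (hp : 1 ≤ p)
    (hq : 1 ≤ q) (f : 𝓢(V, ℂ)) : modNorm g p q (f : 𝓢'(V, ℂ)) < ∞ := by
  obtain ⟨C, hC⟩ := exists_modNorm_le hg g le_rfl le_rfl hp hq
  refine (hC f).trans_lt (ENNReal.mul_lt_top ENNReal.coe_lt_top ?_)
  obtain ⟨C', hC', hs⟩ := exists_norm_stft_schwartz_le g f (Module.finrank ℝ V + 1)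
  have hi := (integrable_decayWeight (V := V) (N := Module.finrank ℝ V + 1)
    (Nat.lt_succ_self _)).lintegral_lt_top
  simp only [modNorm, eLpNorm_one_eq_lintegral_enorm, enorm_eq_self]
  have hm : Measurable fun x : V => ENNReal.ofReal (decayWeight (Module.finrank ℝ V + 1) x) :=
    (continuous_decayWeight _).measurable.ennreal_ofReal
  calc ∫⁻ ω, ∫⁻ x, ‖stft g (f : 𝓢'(V, ℂ)) x ω‖ₑ
      ≤ ∫⁻ ω : V, ∫⁻ x : V, ENNReal.ofReal C' *
          (ENNReal.ofReal (decayWeight (Module.finrank ℝ V + 1) x) *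
            ENNReal.ofReal (decayWeight (Module.finrank ℝ V + 1) ω)) := by
        refine lintegral_mono fun ω => lintegral_mono fun x => ?_
        rw [← ENNReal.ofReal_mul (decayWeight_pos _ _).le, ← ENNReal.ofReal_mul hC', ← ofReal_norm]
        exact ENNReal.ofReal_le_ofReal (hs x ω)
    _ = ENNReal.ofReal C' * ((∫⁻ x : V, ENNReal.ofReal (decayWeight (Module.finrank ℝ V + 1) x)) *
          ∫⁻ x : V, ENNReal.ofReal (decayWeight (Module.finrank ℝ V + 1) x)) := by
        rw [← lintegral_const_mul _ hm, ← lintegral_const_mul _ (by fun_prop)]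
        refine lintegral_congr fun ω => ?_
        rw [lintegral_const_mul _ (by fun_prop), lintegral_mul_const _ hm]
    _ < ∞ := ENNReal.mul_lt_top ENNReal.ofReal_lt_top (ENNReal.mul_lt_top hi hi)

theorem schwartz_mem_modSpaceClosure {g : 𝓢(V, ℂ)} (hg : g ≠ 0) {p q : ℝ≥0∞} (hp : 1 ≤ p)
    (hq : 1 ≤ q) (f : 𝓢(V, ℂ)) : (f : 𝓢'(V, ℂ)) ∈ modSpaceClosure g p q := by
  refine ⟨modNorm_schwartz_lt_top hg hp hq f, fun ε hε => ⟨f, ?_⟩⟩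
  rwa [sub_self, modNorm_zero g]

end ModulationSpace

/-! ### The chirp as a shear of the time-frequency plane. -/

section Chirp

/-- The chirp `η ↦ e^{πi|η|²}`. -/
noncomputable def chirp (η : V) : ℂ := Complex.exp (Real.pi * Complex.I * ((‖η‖ ^ 2 : ℝ) : ℂ))

theorem norm_chirp (η : V) : ‖chirp η‖ = 1 := by
  rw [chirp, Complex.norm_exp]
  simp [-Complex.ofReal_pow]

theorem chirp_hasTemperateGrowth : Function.HasTemperateGrowth (chirp : V → ℂ) := by
  have h1 : Function.HasTemperateGrowth fun η : V => ‖η‖ ^ 2 * (1 / 2) :=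
    (Function.hasTemperateGrowth_norm_sq V).mul (Function.HasTemperateGrowth.const _)
  -- The chirp is the one-dimensional character of frequency 1 evaluated at `‖η‖² / 2`.
  convert (modChar_hasTemperateGrowth (1 : ℝ)).comp h1 using 1
  funext η
  simp only [chirp, modChar, Function.comp_apply]
  congr 1
  simp only [inner, one_mul]
  push_cast
  simp
  ring

theorem chirp_add (η ω : V) : chirp (η + ω) = chirp ω * chirp η * modChar η ω := by
  simp only [chirp, modChar, ← Complex.exp_add]
  congr 1
  rw [norm_add_sq_real, real_inner_comm]
  push_cast
  ring

theorem schrodingerMultiplier_eq (f : 𝓢(V, ℂ)) :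
    schrodingerMultiplier f = SchwartzMap.fourierMultiplierCLM ℂ chirp f := by
  funext x
  rw [SchwartzMap.fourierMultiplierCLM_apply, SchwartzMap.fourierInv_coe, fourierInv_apply_modChar]
  refine integral_congr_ae (Eventually.of_forall fun η => ?_)
  simp only [modChar, SchwartzMap.smulLeftCLM_apply_apply chirp_hasTemperateGrowth, chirp,
    smul_eq_mul, real_inner_comm x η, mul_assoc]

theorem fourierInv_tfShift_neg (x ω : V) (h : 𝓢(V, ℂ)) (η : V) :
    𝓕⁻ (tfShift x (-ω) h) η = modChar (η - ω) x * 𝓕⁻ h (η - ω) := by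
  have h1 : ∀ (f : 𝓢(V, ℂ)) (η : V), 𝓕⁻ f η = 𝓕 f (-η) := fun f η => by
    rw [SchwartzMap.fourierInv_coe, SchwartzMap.fourier_coe]
    exact Real.fourierInv_eq_fourier_neg _ _
  rw [h1, h1, fourier_tfShift]
  congr 2 <;> abel_nf

/-- The transpose of the Schrödinger propagator, acting on Schwartz functions. -/
noncomputable def chirpTranspose (h : 𝓢(V, ℂ)) : 𝓢(V, ℂ) :=
  𝓕 (SchwartzMap.smulLeftCLM ℂ chirp (𝓕⁻ h))

/-- On the Fourier side the shift recentres at `η - ω`, and `chirp η` factors as `chirp ω`, `chirp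
(η - ω)` and a character in `η - ω` that amounts to a further translation by ω. The frequency is
`-ω` because `stft` conjugates the shifted window. -/
theorem chirpTranspose_tfShift (x ω : V) (h : 𝓢(V, ℂ)) :
    chirpTranspose (tfShift x (-ω) h) = chirp ω • tfShift (x + ω) (-ω) (chirpTranspose h) := by
  have key : SchwartzMap.smulLeftCLM ℂ chirp (𝓕⁻ (tfShift x (-ω) h)) =
      𝓕⁻ (chirp ω • tfShift (x + ω) (-ω) (chirpTranspose h)) := by
    ext η
    rw [FourierTransform.fourierInv_smul, smul_apply, fourierInv_tfShift_neg,
      SchwartzMap.smulLeftCLM_apply_apply chirp_hasTemperateGrowth, fourierInv_tfShift_neg,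
      chirpTranspose, FourierTransform.fourierInv_fourier_eq,
      SchwartzMap.smulLeftCLM_apply_apply chirp_hasTemperateGrowth, modChar_add_right]
    have h1 := chirp_add (η - ω) ω
    rw [sub_add_cancel] at h1
    simp only [smul_eq_mul]
    rw [h1]
    ring
  rw [chirpTranspose, key, FourierTransform.fourier_fourierInv_eq]

/-- The chirp never vanishes and the Fourier transform is invertible. This keeps `chirpWindow g`
nonzero, hence admissible in the reproducing formula. -/
theorem chirpTranspose_eq_zero {h : 𝓢(V, ℂ)} (hh : chirpTranspose h = 0) : h = 0 := by
  have h1 : SchwartzMap.smulLeftCLM ℂ chirp (𝓕⁻ h) = 0 := by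
    rw [← FourierTransform.fourierInv_fourier_eq (F := 𝓢(V, ℂ))
      (SchwartzMap.smulLeftCLM ℂ chirp (𝓕⁻ h))]
    change 𝓕⁻ (chirpTranspose h) = 0
    rw [hh, FourierTransform.fourierInv_zero]
  have h2 : 𝓕⁻ h = 0 := by
    ext η
    have h3 := congrArg (fun f : 𝓢(V, ℂ) => f η) h1
    simp only [SchwartzMap.smulLeftCLM_apply_apply chirp_hasTemperateGrowth, smul_eq_mul] at h3
    rcases mul_eq_zero.1 h3 with h4 | h4
    · have := norm_chirp η
      rw [h4, norm_zero] at this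
      exact absurd this zero_ne_one
    · exact h4
  rw [← FourierTransform.fourier_fourierInv_eq (E := 𝓢(V, ℂ)) (F := 𝓢(V, ℂ)) h, h2, FourierTransform.fourier_zero]

/-- The window that turns the short-time Fourier transform of a distribution into that of its image
under the Schrödinger propagator. -/
noncomputable def chirpWindow (g : 𝓢(V, ℂ)) : 𝓢(V, ℂ) :=
  schwartzConj (chirpTranspose (schwartzConj g))

theorem chirpWindow_ne_zero {g : 𝓢(V, ℂ)} (hg : g ≠ 0) : chirpWindow g ≠ 0 := by
  have hc : ∀ f : 𝓢(V, ℂ), schwartzConj f = 0 → f = 0 := fun f hf => by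
    rw [← schwartzConj_schwartzConj f, hf]
    ext y
    simp [schwartzConj_apply]
  exact fun h => hg (hc _ (chirpTranspose_eq_zero (hc _ h)))

theorem stft_fourierMultiplier_chirp (g : 𝓢(V, ℂ)) (u : 𝓢'(V, ℂ)) (x ω : V) :
    stft g (TemperedDistribution.fourierMultiplierCLM ℂ chirp u) x ω =
      chirp ω * stft (chirpWindow g) u (x + ω) ω := by
  rw [stft, TemperedDistribution.fourierMultiplierCLM_apply_apply, schwartzConj_tfShift]
  change u (chirpTranspose _) = _
  rw [chirpTranspose_tfShift, map_smul, stft, schwartzConj_tfShift, chirpWindow,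
    schwartzConj_schwartzConj, smul_eq_mul]

theorem modNorm_fourierMultiplier_chirp (g : 𝓢(V, ℂ)) (p q : ℝ≥0∞) (u : 𝓢'(V, ℂ)) :
    modNorm g p q (TemperedDistribution.fourierMultiplierCLM ℂ chirp u) =
      modNorm (chirpWindow g) p q u := by
  unfold modNorm
  congr 1
  funext ω
  have h1 : eLpNorm (fun x => stft g (TemperedDistribution.fourierMultiplierCLM ℂ chirp u) x ω) p
      volume = eLpNorm (fun x => stft (chirpWindow g) u (x + ω) ω) p volume :=
    eLpNorm_congr_norm_ae (Eventually.of_forall fun x => by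
      rw [stft_fourierMultiplier_chirp, norm_mul, norm_chirp, one_mul])
  rw [h1]
  exact eLpNorm_comp_measurePreserving (g := fun x => stft (chirpWindow g) u x ω)
    ((continuous_stft (chirpWindow g) u).comp
      (Continuous.prodMk_left ω)).aestronglyMeasurable (measurePreserving_add_right volume ω)

theorem isGivenBy_schwartz (f : 𝓢(V, ℂ)) : IsGivenBy (f : 𝓢'(V, ℂ)) f := by
  intro φ
  refine ⟨(SchwartzMap.pairing (ContinuousLinearMap.mul ℂ ℂ) φ f).integrable, ?_⟩
  rw [SchwartzMap.coe_apply]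
  rfl

/-- The extension is the Fourier multiplier on tempered distributions, restricted. It respects the
closures because it is bounded and maps Schwartz functions to Schwartz functions. -/
theorem isBoundedOnMod_schrodingerMultiplier {g : 𝓢(V, ℂ)} (hg : g ≠ 0) {r₁ r₂ t₁ t₂ : ℝ≥0∞}
    (hr₁ : 1 ≤ r₁) (hr₂ : 1 ≤ r₂) (h₁ : r₁ ≤ t₁) (h₂ : r₂ ≤ t₂) :
    IsBoundedOnMod g r₁ r₂ t₁ t₂ schrodingerMultiplier := by
  set A := TemperedDistribution.fourierMultiplierCLM ℂ (chirp : V → ℂ)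
  obtain ⟨C, hC⟩ := exists_modNorm_le hg (chirpWindow g) hr₁ hr₂ h₁ h₂
  have hA : ∀ u, modNorm g t₁ t₂ (A u) ≤ C * modNorm g r₁ r₂ u := fun u =>
    (modNorm_fourierMultiplier_chirp g t₁ t₂ u).trans_le (hC u)
  have hAf : ∀ f : 𝓢(V, ℂ), A (f : 𝓢'(V, ℂ)) =
      (SchwartzMap.fourierMultiplierCLM ℂ chirp f : 𝓢'(V, ℂ)) := fun f =>
    TemperedDistribution.fourierMultiplierCLM_toTemperedDistributionCLM_eq
      chirp_hasTemperateGrowth f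
  refine ⟨⟨modSpaceClosureSubmodule g hr₁ hr₂,
    (A : 𝓢'(V, ℂ) →ₗ[ℂ] 𝓢'(V, ℂ)) ∘ₗ (modSpaceClosureSubmodule g hr₁ hr₂).subtype⟩, rfl,
    fun f hf => ?_, fun u => ?_, C, fun u => hA u⟩
  · change IsGivenBy (A (f : 𝓢'(V, ℂ))) _
    rw [hAf, schrodingerMultiplier_eq]
    exact isGivenBy_schwartz _
  · obtain ⟨u, hu, hu'⟩ := u
    change A u ∈ _
    refine ⟨(hA u).trans_lt (ENNReal.mul_lt_top ENNReal.coe_lt_top hu), fun ε hε => ?_⟩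
    obtain ⟨f, hf⟩ := hu' (ε / (C + 1))
      (ENNReal.div_pos hε.ne' (ENNReal.add_ne_top.2 ⟨ENNReal.coe_ne_top, ENNReal.one_ne_top⟩))
    refine ⟨SchwartzMap.fourierMultiplierCLM ℂ chirp f, ?_⟩
    rw [← hAf, ← map_sub]
    refine (hA _).trans_lt (lt_of_le_of_lt (mul_le_mul_left
      (le_add_right le_rfl : (C : ℝ≥0∞) ≤ C + 1) _) ?_)
    rw [mul_comm]
    exact ENNReal.mul_lt_of_lt_div hf

/-- Boundedness of the Schrödinger multiplier implies an embedding on Schwartz functions. -/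
theorem IsBoundedOnMod.exists_modNorm_le {g : 𝓢(V, ℂ)} (hg : g ≠ 0) {r₁ r₂ t₁ t₂ : ℝ≥0∞}
    (hr₁ : 1 ≤ r₁) (hr₂ : 1 ≤ r₂) (ht₁ : 1 ≤ t₁) (ht₂ : 1 ≤ t₂)
    (hT : IsBoundedOnMod g r₁ r₂ t₁ t₂ schrodingerMultiplier) {φ : 𝓢(V, ℂ)} (hφ : φ ≠ 0) :
    ∃ C : ℝ≥0, ∀ f : 𝓢(V, ℂ), modNorm φ t₁ t₂ (f : 𝓢'(V, ℂ)) ≤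
      C * modNorm φ r₁ r₂ (f : 𝓢'(V, ℂ)) := by
  obtain ⟨A, hdom, hA, -, C, hC⟩ := hT
  obtain ⟨C₁, h₁⟩ := _root_.exists_modNorm_le (chirpWindow_ne_zero hg) φ ht₁ ht₂ le_rfl le_rfl
  obtain ⟨C₂, h₂⟩ := _root_.exists_modNorm_le hφ g hr₁ hr₂ le_rfl le_rfl
  refine ⟨C₁ * C * C₂, fun f => ?_⟩
  have hf : (f : 𝓢'(V, ℂ)) ∈ A.domain := by
    rw [← SetLike.mem_coe, hdom]
    exact schwartz_mem_modSpaceClosure hg hr₁ hr₂ f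
  -- A tempered distribution given by a function is determined by its pairings with test functions,
  -- so any bounded extension agrees with the multiplier on Schwartz functions.
  have hAf : A ⟨f, hf⟩ = TemperedDistribution.fourierMultiplierCLM ℂ chirp (f : 𝓢'(V, ℂ)) := by
    rw [TemperedDistribution.fourierMultiplierCLM_toTemperedDistributionCLM_eq
      chirp_hasTemperateGrowth]
    ext ψ
    rw [(hA f hf ψ).2, schrodingerMultiplier_eq]
    exact (isGivenBy_schwartz _ ψ).2.symm
  have h3 := hC ⟨f, hf⟩
  rw [hAf, modNorm_fourierMultiplier_chirp] at h3
  calc modNorm φ t₁ t₂ (f : 𝓢'(V, ℂ)) ≤ C₁ * (C * (C₂ * modNorm φ r₁ r₂ (f : 𝓢'(V, ℂ)))) :=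
        (h₁ f).trans (mul_le_mul_right (h3.trans (mul_le_mul_right (h₂ f) _)) _)
    _ = _ := by
        push_cast
        ring

end Chirp

end Boundedness

/-! ### Necessity: sums of separated translates and modulations. -/

section Necessity

open Filter Topology

/-- At most one summand is nonzero, so both sides reduce to it. Additivity of `h` is not needed,
which allows norms and powers. -/
theorem Finset.map_sum_of_disjoint {ι M M' : Type*} [AddCommMonoid M] [AddCommMonoid M']
    (s : Finset ι) {f : ι → M} (hf : ∀ i ∈ s, ∀ j ∈ s, i ≠ j → f i = 0 ∨ f j = 0)
    {h : M → M'} (h0 : h 0 = 0) : h (∑ i ∈ s, f i) = ∑ i ∈ s, h (f i) := by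
  by_cases hall : ∀ i ∈ s, f i = 0
  · rw [Finset.sum_eq_zero hall, Finset.sum_eq_zero fun i hi => by rw [hall i hi, h0], h0]
  · push Not at hall
    obtain ⟨i, hi, hfi⟩ := hall
    have h1 : ∀ j ∈ s, j ≠ i → f j = 0 := fun j hj hji => (hf i hi j hj hji.symm).resolve_left hfi
    rw [Finset.sum_eq_single_of_mem i hi h1,
      Finset.sum_eq_single_of_mem i hi fun j hj hji => by rw [h1 j hj hji, h0]]

/-- The `L^p` norm of a sum of `N` disjointly supported functions of equal norm. -/
theorem eLpNorm_sum_of_disjoint {α : Type*} [MeasurableSpace α] {μ : Measure α} {N : ℕ}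
    (hN : N ≠ 0) {F : ℕ → α → ℝ≥0∞} (hF : ∀ j, Measurable (F j))
    (hdisj : ∀ a i j, i ≠ j → F i a = 0 ∨ F j a = 0) {p A : ℝ≥0∞} (hp : p ≠ 0)
    (hA : ∀ j, eLpNorm (F j) p μ = A) :
    eLpNorm (fun a => ∑ j ∈ Finset.range N, F j a) p μ = (N : ℝ≥0∞) ^ (1 / p.toReal) * A := by
  rcases eq_or_ne p ∞ with rfl | hp'
  -- With the convention `1 / 0 = 0` the factor is `N ^ 0 = 1`, as it should be for a supremum.
  · simp only [ENNReal.toReal_top, div_zero, ENNReal.rpow_zero, one_mul]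
    refine le_antisymm ?_ ?_
    · have hA' : ∀ᵐ a ∂μ, ∀ j, F j a ≤ A := by
        rw [ae_all_iff]
        intro j
        filter_upwards [enorm_ae_le_eLpNormEssSup (F j) μ] with a ha
        rwa [← eLpNorm_exponent_top, hA j] at ha
      rw [eLpNorm_exponent_top]
      refine essSup_le_of_ae_le _ ?_
      filter_upwards [hA'] with a ha
      change ∑ j ∈ Finset.range N, F j a ≤ A
      by_cases hall : ∀ j ∈ Finset.range N, F j a = 0
      · rw [Finset.sum_eq_zero hall]
        exact zero_le
      · push Not at hall
        obtain ⟨i, hi, hfi⟩ := hall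
        rw [Finset.sum_eq_single_of_mem i hi fun j _ hji =>
          (hdisj a i j hji.symm).resolve_left hfi]
        exact ha i
    · rw [← hA 0]
      refine eLpNorm_mono_enorm fun a => ?_
      exact Finset.single_le_sum (f := fun j => F j a) (fun j _ => zero_le)
        (Finset.mem_range.2 (Nat.pos_of_ne_zero hN))
  · have h0 : 0 < p.toReal := ENNReal.toReal_pos hp hp'
    have hA' : ∀ j, ∫⁻ a, F j a ^ p.toReal ∂μ = A ^ p.toReal := fun j => by
      rw [← hA j, eLpNorm_ennreal_eq_lintegral hp hp', ← ENNReal.rpow_mul, one_div,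
        inv_mul_cancel₀ h0.ne', ENNReal.rpow_one]
    rw [eLpNorm_ennreal_eq_lintegral hp hp']
    have h1 : ∀ a, (∑ j ∈ Finset.range N, F j a) ^ p.toReal =
        ∑ j ∈ Finset.range N, F j a ^ p.toReal := fun a =>
      Finset.map_sum_of_disjoint (h := fun x : ℝ≥0∞ => x ^ p.toReal) _
        (fun i _ j _ hij => hdisj a i j hij) (ENNReal.zero_rpow_of_pos h0)
    simp only [h1]
    rw [lintegral_finsetSum _ fun j _ => (hF j).pow_const _]
    simp only [hA', Finset.sum_const, Finset.card_range, nsmul_eq_mul]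
    rw [ENNReal.mul_rpow_of_nonneg _ _ (by positivity), ← ENNReal.rpow_mul,
      mul_one_div_cancel h0.ne', ENNReal.rpow_one]

theorem ENNReal.le_of_natCast_rpow_le {r t K : ℝ≥0∞} (hr : r ≠ 0) (ht : t ≠ 0) (hK : K ≠ ∞)
    (h : ∀ N : ℕ, N ≠ 0 → (N : ℝ≥0∞) ^ (1 / t.toReal) ≤ K * (N : ℝ≥0∞) ^ (1 / r.toReal)) :
    r ≤ t := by
  by_contra! hlt
  have ht' : t ≠ ∞ := hlt.ne_top
  have h0 : 0 < t.toReal := ENNReal.toReal_pos ht ht'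
  have hδ : 0 < 1 / t.toReal - 1 / r.toReal := by
    rcases eq_or_ne r ∞ with rfl | hr'
    · simpa using h0
    · exact sub_pos.2 (one_div_lt_one_div_of_lt h0 ((ENNReal.toReal_lt_toReal ht' hr').2 hlt))
  set δ := 1 / t.toReal - 1 / r.toReal
  -- The hypothesis reduces to `N ^ δ ≤ K`, which fails once `N` exceeds `K ^ δ⁻¹`. The 1 in the
  -- maximum keeps `N` nonzero.
  obtain ⟨N, hN⟩ := ENNReal.exists_nat_gt
    (r := max 1 (K ^ δ⁻¹)) (max_lt ENNReal.one_lt_top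
      (ENNReal.rpow_lt_top_of_nonneg (inv_nonneg.2 hδ.le) hK)).ne
  have hN1 : (1 : ℝ≥0∞) < N := (le_max_left _ _).trans_lt hN
  have hN0 : (N : ℝ≥0∞) ≠ 0 := (zero_lt_one.trans hN1).ne'
  have h1 := h N (by exact_mod_cast hN0)
  have h2 : (N : ℝ≥0∞) ^ (1 / t.toReal) =
      (N : ℝ≥0∞) ^ δ * (N : ℝ≥0∞) ^ (1 / r.toReal) := by
    rw [← ENNReal.rpow_add _ _ hN0 (ENNReal.natCast_ne_top N)]
    congr 1
    simp [δ]
  rw [h2, ENNReal.mul_le_mul_iff_left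
    (ENNReal.rpow_pos (pos_iff_ne_zero.2 hN0) (ENNReal.natCast_ne_top N)).ne'
    (ENNReal.rpow_ne_top_of_nonneg (by positivity) (ENNReal.natCast_ne_top N))] at h1
  have h3 := ENNReal.rpow_le_rpow h1 (inv_nonneg.2 hδ.le)
  rw [← ENNReal.rpow_mul, mul_inv_cancel₀ hδ.ne', ENNReal.rpow_one] at h3
  exact absurd ((le_max_right _ _).trans_lt hN) (not_lt.2 h3)

variable {V : Type*} [NormedAddCommGroup V] [InnerProductSpace ℝ V] [FiniteDimensional ℝ V]
  [MeasurableSpace V] [BorelSpace V]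

theorem eLpNorm_comp_sub_right {ε : Type*} [TopologicalSpace ε] [ContinuousENorm ε] {f : V → ε}
    (hf : AEStronglyMeasurable f (volume : Measure V)) (a : V) (p : ℝ≥0∞) :
    eLpNorm (fun x => f (x - a)) p volume = eLpNorm f p volume :=
  eLpNorm_comp_measurePreserving hf (measurePreserving_sub_right volume a)

theorem stft_tfShift (g f : 𝓢(V, ℂ)) (a b x ω : V) :
    stft g (tfShift a b f : 𝓢'(V, ℂ)) x ω =
      modChar (-(ω - b)) a * stft g (f : 𝓢'(V, ℂ)) (x - a) (ω - b) := by
  rw [stft_schwartz, stft_schwartz, ← integral_const_mul]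
  refine (integral_add_right_eq_self _ a).symm.trans
    (integral_congr_ae (Eventually.of_forall fun y => ?_))
  simp only [tfShift_apply, conj_modChar, add_sub_cancel_right]
  have h1 : y + a - x = y - (x - a) := by abel
  have h2 : modChar (-ω) (y + a) * modChar b (y + a) =
      modChar (-(ω - b)) a * modChar (-(ω - b)) y := by
    rw [← modChar_add, ← modChar_add_right]
    congr 1 <;> abel
  rw [h1]
  linear_combination (f y * (starRingEnd ℂ) (g (y - (x - a)))) * h2

theorem enorm_stft_tfShift (g f : 𝓢(V, ℂ)) (a b x ω : V) :
    ‖stft g (tfShift a b f : 𝓢'(V, ℂ)) x ω‖ₑ =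
      ‖stft g (f : 𝓢'(V, ℂ)) (x - a) (ω - b)‖ₑ := by
  rw [stft_tfShift, ← ofReal_norm, ← ofReal_norm, norm_mul, norm_modChar, one_mul]

theorem stft_tfShift_eq_zero_iff (g f : 𝓢(V, ℂ)) (a b x ω : V) :
    stft g (tfShift a b f : 𝓢'(V, ℂ)) x ω = 0 ↔
      stft g (f : 𝓢'(V, ℂ)) (x - a) (ω - b) = 0 := by
  rw [← norm_eq_zero, stft_tfShift, norm_mul, norm_modChar, one_mul, norm_eq_zero]

theorem stft_sum (g : 𝓢(V, ℂ)) (s : Finset ℕ) (f : ℕ → 𝓢(V, ℂ)) (x ω : V) :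
    stft g ((∑ j ∈ s, f j : 𝓢(V, ℂ)) : 𝓢'(V, ℂ)) x ω =
      ∑ j ∈ s, stft g (f j : 𝓢'(V, ℂ)) x ω := by
  let L : 𝓢'(V, ℂ) →ₗ[ℂ] ℂ :=
    { toFun := fun u => stft g u x ω
      map_add' := fun _ _ => rfl
      map_smul' := fun _ _ => rfl }
  have h : L ((∑ j ∈ s, f j : 𝓢(V, ℂ)) : 𝓢'(V, ℂ)) = ∑ j ∈ s, L (f j : 𝓢'(V, ℂ)) := by
    rw [map_sum, map_sum]
  exact h

/-- A nonzero integrand would require both `y` and `y - x` in the ball of radius `R`, so `‖x‖ ≤ 2 *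
R`. -/
theorem integral_norm_mul_eq_zero_of_support {f : V → ℂ} {R : ℝ} (hf : ∀ y, R < ‖y‖ → f y = 0)
    {x : V} (hx : 2 * R < ‖x‖) : ∫ y, ‖f y‖ * ‖f (y - x)‖ = 0 := by
  refine integral_eq_zero_of_ae (Eventually.of_forall fun y => ?_)
  rcases lt_or_ge R ‖y‖ with h | h
  · simp [hf y h]
  · have h1 : ‖x‖ ≤ ‖y‖ + ‖y - x‖ := by
      have := norm_sub_le y (y - x)
      rwa [sub_sub_cancel] at this
    simp [hf (y - x) (by linarith)]

theorem stft_self_eq_zero {φ : 𝓢(V, ℂ)} {R : ℝ} (hφ : ∀ y, R < ‖y‖ → φ y = 0) {x : V}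
    (hx : 2 * R < ‖x‖) (ω : V) : stft φ (φ : 𝓢'(V, ℂ)) x ω = 0 := by
  have h := norm_stft_schwartz_le φ φ x ω
  rw [integral_norm_mul_eq_zero_of_support hφ hx] at h
  exact norm_le_zero_iff.1 h

theorem stft_self_eq_zero_of_fourier {φ : 𝓢(V, ℂ)} {R : ℝ} (hφ : ∀ y, R < ‖y‖ → 𝓕 φ y = 0)
    {ω : V} (hω : 2 * R < ‖ω‖) (x : V) : stft φ (φ : 𝓢'(V, ℂ)) x ω = 0 := by
  have h := norm_stft_schwartz_le_fourier φ φ x ω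
  rw [integral_norm_mul_eq_zero_of_support hφ hω] at h
  exact norm_le_zero_iff.1 h

/-- Distinct multiples of `v` are more than `2 * R` apart, so they cannot both lie within `R` of
`x`. It is used with `2 * R` for `R`, the radius of the support of the transform. -/
theorem lt_norm_sub_smul_or {R : ℝ} {v : V} (hv : 2 * R < ‖v‖) (x : V) {i j : ℕ} (hij : i ≠ j) :
    R < ‖x - (i : ℝ) • v‖ ∨ R < ‖x - (j : ℝ) • v‖ := by
  by_contra! h
  have h1 : ‖((i : ℝ) - j) • v‖ ≤ R + R := by
    have h2 : ((i : ℝ) - j) • v = (x - (j : ℝ) • v) - (x - (i : ℝ) • v) := by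
      module
    rw [h2]
    exact (norm_sub_le _ _).trans (add_le_add h.2 h.1)
  have h3 : (1 : ℝ) ≤ |(i : ℝ) - j| := by
    have : (1 : ℤ) ≤ |(i : ℤ) - j| := Int.one_le_abs (sub_ne_zero.2 (by exact_mod_cast hij))
    exact_mod_cast this
  rw [norm_smul, Real.norm_eq_abs] at h1
  nlinarith [norm_nonneg v]

theorem stft_self_translate_eq_zero_or {φ : 𝓢(V, ℂ)} {R : ℝ} (hφ : ∀ y, R < ‖y‖ → φ y = 0) {v : V}
    (hv : 2 * (2 * R) < ‖v‖) (x ω : V) {i j : ℕ} (hij : i ≠ j) :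
    stft φ (φ : 𝓢'(V, ℂ)) (x - (i : ℝ) • v) ω = 0 ∨
      stft φ (φ : 𝓢'(V, ℂ)) (x - (j : ℝ) • v) ω = 0 :=
  (lt_norm_sub_smul_or hv x hij).imp (fun h => stft_self_eq_zero hφ h ω)
    (fun h => stft_self_eq_zero hφ h ω)

theorem enorm_stft_sum_translates {φ : 𝓢(V, ℂ)} {R : ℝ} (hφ : ∀ y, R < ‖y‖ → φ y = 0) {v : V}
    (hv : 2 * (2 * R) < ‖v‖) (N : ℕ) (x ω : V) :
    ‖stft φ ((∑ j ∈ Finset.range N, tfShift ((j : ℝ) • v) 0 φ : 𝓢(V, ℂ)) : 𝓢'(V, ℂ)) x ω‖ₑ =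
      ∑ j ∈ Finset.range N, ‖stft φ (φ : 𝓢'(V, ℂ)) (x - (j : ℝ) • v) ω‖ₑ := by
  rw [stft_sum, Finset.map_sum_of_disjoint (h := fun z : ℂ => ‖z‖ₑ) _ (fun i _ j _ hij => ?_)
    enorm_zero]
  · simp only [enorm_stft_tfShift, sub_zero]
  · simpa only [stft_tfShift_eq_zero_iff, sub_zero] using
      stft_self_translate_eq_zero_or hφ hv x ω hij

theorem continuous_stft_left (g : 𝓢(V, ℂ)) (u : 𝓢'(V, ℂ)) (ω : V) :
    Continuous fun x => stft g u x ω :=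
  Continuous.comp (f := fun x : V => (x, ω)) (g := fun z : V × V => stft g u z.1 z.2)
    (continuous_stft g u) (by fun_prop)

theorem continuous_stft_right (g : 𝓢(V, ℂ)) (u : 𝓢'(V, ℂ)) (x : V) :
    Continuous fun ω => stft g u x ω :=
  Continuous.comp (f := fun ω : V => (x, ω)) (g := fun z : V × V => stft g u z.1 z.2)
    (continuous_stft g u) (by fun_prop)

theorem modNorm_sum_translates {φ : 𝓢(V, ℂ)} {R : ℝ} (hφ : ∀ y, R < ‖y‖ → φ y = 0) {v : V}
    (hv : 2 * (2 * R) < ‖v‖) {N : ℕ} (hN : N ≠ 0) {p : ℝ≥0∞} (hp : p ≠ 0) (q : ℝ≥0∞) :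
    modNorm φ p q ((∑ j ∈ Finset.range N, tfShift ((j : ℝ) • v) 0 φ : 𝓢(V, ℂ)) : 𝓢'(V, ℂ)) =
      (N : ℝ≥0∞) ^ (1 / p.toReal) * modNorm φ p q (φ : 𝓢'(V, ℂ)) := by
  have h1 : ∀ ω : V, eLpNorm (fun x => stft φ ((∑ j ∈ Finset.range N, tfShift ((j : ℝ) • v) 0 φ :
      𝓢(V, ℂ)) : 𝓢'(V, ℂ)) x ω) p volume = (N : ℝ≥0∞) ^ (1 / p.toReal) *
        eLpNorm (fun x => stft φ (φ : 𝓢'(V, ℂ)) x ω) p volume := by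
    intro ω
    have hm : Continuous fun x => stft φ (φ : 𝓢'(V, ℂ)) x ω :=
      continuous_stft_left φ _ ω
    have hm' : ∀ j : ℕ, Measurable fun x =>
        ‖stft φ (φ : 𝓢'(V, ℂ)) (x - (j : ℝ) • v) ω‖ₑ := fun j =>
      hm.enorm.measurable.comp (measurable_sub_const _)
    have h2 := eLpNorm_sum_of_disjoint (μ := volume) hN
      (F := fun j x => ‖stft φ (φ : 𝓢'(V, ℂ)) (x - (j : ℝ) • v) ω‖ₑ)
      hm' (fun x i j hij => (stft_self_translate_eq_zero_or hφ hv x ω hij).imp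
        (fun h => enorm_eq_zero.2 h) (fun h => enorm_eq_zero.2 h)) hp
      (fun j => (eLpNorm_enorm _).trans (eLpNorm_comp_sub_right hm.aestronglyMeasurable _ p))
    rw [← h2, ← eLpNorm_enorm]
    congr 1
    funext x
    exact enorm_stft_sum_translates hφ hv N x ω
  unfold modNorm
  simp only [h1]
  exact eLpNorm_ennreal_const_mul _ (measurable_eLpNorm_stft φ φ hp) q

/-- Here the disjointness is in ω: for each ω at most one summand is a nonzero function of x, so the
inner norm of the sum is the sum of the inner norms, and the outer norm counts the pieces. -/
theorem modNorm_sum_modulations {φ : 𝓢(V, ℂ)} {R : ℝ} (hφ : ∀ y, R < ‖y‖ → 𝓕 φ y = 0) {v : V}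
    (hv : 2 * (2 * R) < ‖v‖) {N : ℕ} (hN : N ≠ 0) {p q : ℝ≥0∞} (hp : p ≠ 0) (hq : q ≠ 0) :
    modNorm φ p q ((∑ j ∈ Finset.range N, tfShift 0 ((j : ℝ) • v) φ : 𝓢(V, ℂ)) : 𝓢'(V, ℂ)) =
      (N : ℝ≥0∞) ^ (1 / q.toReal) * modNorm φ p q (φ : 𝓢'(V, ℂ)) := by
  have hdisj : ∀ ω : V, ∀ i j : ℕ, i ≠ j →
      (fun x => stft φ (φ : 𝓢'(V, ℂ)) x (ω - (i : ℝ) • v)) = 0 ∨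
        (fun x => stft φ (φ : 𝓢'(V, ℂ)) x (ω - (j : ℝ) • v)) = 0 := fun ω i j hij =>
    (lt_norm_sub_smul_or hv ω hij).imp
      (fun h => funext fun x => stft_self_eq_zero_of_fourier hφ h x)
      (fun h => funext fun x => stft_self_eq_zero_of_fourier hφ h x)
  have hsh : ∀ (j : ℕ) (ω : V), eLpNorm (fun x => stft φ
      (tfShift 0 ((j : ℝ) • v) φ : 𝓢'(V, ℂ)) x ω) p volume =
        eLpNorm (fun x => stft φ (φ : 𝓢'(V, ℂ)) x (ω - (j : ℝ) • v)) p volume := by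
    intro j ω
    rw [← eLpNorm_enorm]
    simp only [enorm_stft_tfShift, sub_zero]
    rw [eLpNorm_enorm]
  have h1 : ∀ ω : V, eLpNorm (fun x => stft φ ((∑ j ∈ Finset.range N, tfShift 0 ((j : ℝ) • v) φ :
      𝓢(V, ℂ)) : 𝓢'(V, ℂ)) x ω) p volume =
        ∑ j ∈ Finset.range N,
          eLpNorm (fun x => stft φ (φ : 𝓢'(V, ℂ)) x (ω - (j : ℝ) • v)) p volume := by
    intro ω
    have h2 : (fun x => stft φ ((∑ j ∈ Finset.range N, tfShift 0 ((j : ℝ) • v) φ :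
        𝓢(V, ℂ)) : 𝓢'(V, ℂ)) x ω) = ∑ j ∈ Finset.range N,
          fun x => stft φ (tfShift 0 ((j : ℝ) • v) φ : 𝓢'(V, ℂ)) x ω := by
      funext x
      rw [stft_sum, Finset.sum_apply]
    rw [h2, Finset.map_sum_of_disjoint (h := fun f : V → ℂ => eLpNorm f p volume) _ _ eLpNorm_zero]
    · simp only [hsh]
    · intro i _ j _ hij
      refine (hdisj ω i j hij).imp (fun h => ?_) (fun h => ?_) <;>
      · funext x
        have := congrFun h x
        simpa only [Pi.zero_apply, stft_tfShift_eq_zero_iff, sub_zero] using this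
  simp only [modNorm, h1]
  have hm := measurable_eLpNorm_stft φ (φ : 𝓢'(V, ℂ)) hp
  refine eLpNorm_sum_of_disjoint hN (fun j => hm.comp (measurable_sub_const _))
    (fun ω i j hij => ?_) hq fun j => ?_
  · refine (hdisj ω i j hij).imp (fun h => ?_) (fun h => ?_) <;>
    · simp only [Function.comp_apply]
      rw [h, eLpNorm_zero]
  · exact eLpNorm_comp_sub_right hm.aestronglyMeasurable _ q

/-- Through the embedding into `M^{∞,∞}`, a zero norm would make the continuous transform vanish at
the origin, where its value is the squared `L²` norm of φ. -/
theorem modNorm_self_ne_zero {φ : 𝓢(V, ℂ)} (hφ : φ ≠ 0) {p q : ℝ≥0∞} (hp : 1 ≤ p) (hq : 1 ≤ q) :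
    modNorm φ p q (φ : 𝓢'(V, ℂ)) ≠ 0 := by
  intro h
  obtain ⟨C, hC⟩ := exists_modNorm_le hφ φ hp hq (le_top : p ≤ ∞) (le_top : q ≤ ∞)
  have h1 := hC φ
  rw [h, mul_zero] at h1
  have h2 : eLpNorm (fun ω => ‖stft φ (φ : 𝓢'(V, ℂ)) 0 ω‖ₑ) ∞ volume ≤ 0 := by
    refine le_trans (eLpNorm_mono_enorm fun ω => ?_) h1
    simp only [enorm_eq_self]
    rw [eLpNorm_exponent_top]
    exact (le_iSup (fun x => ‖stft φ (φ : 𝓢'(V, ℂ)) x ω‖ₑ) 0).trans_eq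
      (essSup_eq_iSup_of_continuous
        (continuous_stft_left φ _ ω).enorm).symm
  rw [eLpNorm_enorm, eLpNorm_exponent_top] at h2
  replace h2 := (essSup_eq_iSup_of_continuous
      (continuous_stft_right φ _ 0).enorm).symm.trans_le h2
  have h3 := (le_iSup (fun ω => ‖stft φ (φ : 𝓢'(V, ℂ)) 0 ω‖ₑ) 0).trans h2
  have h4 : stft φ (φ : 𝓢'(V, ℂ)) 0 0 = ((∫ y, ‖φ y‖ ^ 2 : ℝ) : ℂ) := by
    rw [stft_schwartz, ← integral_complex_ofReal]
    refine integral_congr_ae (Eventually.of_forall fun y => ?_)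
    simp only [sub_zero, modChar, inner_zero_right, Complex.ofReal_zero, mul_zero,
      Complex.exp_zero, map_one, one_mul, Complex.mul_conj, Complex.normSq_eq_norm_sq]
  have h5 : stft φ (φ : 𝓢'(V, ℂ)) 0 0 = 0 := by simpa using h3
  rw [h4] at h5
  exact (SchwartzMap.integral_norm_sq_pos hφ).ne' (by exact_mod_cast h5)

theorem SchwartzMap.exists_support_subset_ball :
    ∃ φ : 𝓢(V, ℂ), φ ≠ 0 ∧ ∀ y, 1 < ‖y‖ → φ y = 0 := by
  let b : ContDiffBump (0 : V) := ⟨1 / 2, 1, by norm_num, by norm_num⟩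
  have hs : ContDiff ℝ ((⊤ : ℕ∞) : WithTop ℕ∞) fun y => ((b y : ℝ) : ℂ) :=
    Complex.ofRealCLM.contDiff.comp b.contDiff
  have hc : HasCompactSupport fun y => ((b y : ℝ) : ℂ) :=
    b.hasCompactSupport.comp_left Complex.ofReal_zero
  refine ⟨hc.toSchwartzMap hs, fun h => ?_, fun y hy => ?_⟩
  · have h1 := congrArg (fun f : 𝓢(V, ℂ) => f 0) h
    change ((b 0 : ℝ) : ℂ) = 0 at h1
    rw [b.one_of_mem_closedBall (by simp [b])] at h1
    simp at h1
  · change ((b y : ℝ) : ℂ) = 0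
    rw [b.zero_of_le_dist (by simpa [b] using hy.le), Complex.ofReal_zero]

theorem IsBoundedOnMod.le_and_le [Nontrivial V] {g : 𝓢(V, ℂ)} (hg : g ≠ 0) {r₁ r₂ t₁ t₂ : ℝ≥0∞}
    (hr₁ : 1 ≤ r₁) (hr₂ : 1 ≤ r₂) (ht₁ : 1 ≤ t₁) (ht₂ : 1 ≤ t₂)
    (hT : IsBoundedOnMod g r₁ r₂ t₁ t₂ schrodingerMultiplier) : r₁ ≤ t₁ ∧ r₂ ≤ t₂ := by
  obtain ⟨φ, hφ, hsupp⟩ := SchwartzMap.exists_support_subset_ball (V := V)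
  -- Any length above 4 separates the transforms, whose supports have radius 2; a nontrivial space
  -- contains such a vector.
  obtain ⟨v, hv⟩ := exists_norm_eq V (by norm_num : (0 : ℝ) ≤ 5)
  have hv' : 2 * (2 * 1) < ‖v‖ := by rw [hv]; norm_num
  have hne : ∀ {s : ℝ≥0∞}, 1 ≤ s → s ≠ 0 := fun h => (zero_lt_one.trans_le h).ne'
  have key : ∀ {a b C A B : ℝ≥0∞}, A ≠ 0 → A ≠ ∞ → a * A ≤ C * (b * B) → a ≤ (C * B / A) * b := by
    intro a b C A B hA hA' h
    rw [← ENNReal.mul_div_right_comm, ENNReal.le_div_iff_mul_le (Or.inl hA) (Or.inl hA')]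
    calc a * A ≤ C * (b * B) := h
      _ = C * B * b := by ring
  constructor
  · obtain ⟨C, hC⟩ := hT.exists_modNorm_le hg hr₁ hr₂ ht₁ ht₂ hφ
    have hA := modNorm_self_ne_zero hφ ht₁ ht₂
    refine ENNReal.le_of_natCast_rpow_le (hne hr₁) (hne ht₁) (ENNReal.div_ne_top
      (ENNReal.mul_ne_top (ENNReal.coe_ne_top (r := C)) (modNorm_schwartz_lt_top hφ hr₁ hr₂ φ).ne) hA)
      fun N hN => key (C := C) hA (modNorm_schwartz_lt_top hφ ht₁ ht₂ φ).ne ?_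
    rw [← modNorm_sum_translates hsupp hv' hN (hne hr₁), ← modNorm_sum_translates hsupp hv' hN
      (hne ht₁)]
    exact hC _
  -- For the frequency exponents the test function is band-limited: its Fourier transform is the
  -- bump φ.
  · have hφ' : 𝓕⁻ φ ≠ 0 := fun h => hφ (by
      rw [← FourierTransform.fourier_fourierInv_eq (E := 𝓢(V, ℂ)) (F := 𝓢(V, ℂ)) φ, h,
        FourierTransform.fourier_zero])
    have hsupp' : ∀ y, 1 < ‖y‖ → 𝓕 (𝓕⁻ φ) y = 0 := by
      rwa [FourierTransform.fourier_fourierInv_eq]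
    obtain ⟨C, hC⟩ := hT.exists_modNorm_le hg hr₁ hr₂ ht₁ ht₂ hφ'
    have hA := modNorm_self_ne_zero hφ' ht₁ ht₂
    refine ENNReal.le_of_natCast_rpow_le (hne hr₂) (hne ht₂) (ENNReal.div_ne_top
      (ENNReal.mul_ne_top (ENNReal.coe_ne_top (r := C)) (modNorm_schwartz_lt_top hφ' hr₁ hr₂ (𝓕⁻ φ)).ne) hA)
      fun N hN => key (C := C) hA (modNorm_schwartz_lt_top hφ' ht₁ ht₂ (𝓕⁻ φ)).ne ?_
    rw [← modNorm_sum_modulations hsupp' hv' hN (hne hr₁) (hne hr₂),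
      ← modNorm_sum_modulations hsupp' hv' hN (hne ht₁) (hne ht₂)]
    exact hC _

end Necessity

/-! ### The constant symbol in Sjöstrand's class. -/

section ConstantSymbol

variable {V : Type*} [NormedAddCommGroup V] [InnerProductSpace ℝ V] [FiniteDimensional ℝ V]
  [MeasurableSpace V] [BorelSpace V]

/-- The constant function 1, as a distribution, is Lebesgue measure. The modulus of its transform
does not depend on x and is a Schwartz function's modulus in ω, whence the `M^{∞,1}` bound. -/
theorem stft_volume (g : 𝓢(V, ℂ)) (x ω : V) :
    stft g (volume : Measure V).toTemperedDistribution x ω =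
      (starRingEnd ℂ) (modChar ω x * 𝓕⁻ (g : V → ℂ) ω) := by
  rw [stft, fourierInv_apply_modChar]
  refine (Measure.toTemperedDistribution_apply _ _).trans ?_
  simp only [schwartzConj_apply, tfShift_apply]
  rw [integral_conj, ← integral_const_mul,
    ← integral_add_right_eq_self (fun y => modChar ω y * g (y - x)) x]
  simp only [add_sub_cancel_right, modChar_add_right]
  congr 2
  funext y
  ring

theorem modNorm_volume_lt_top (g : 𝓢(V, ℂ)) :
    modNorm g ∞ 1 (volume : Measure V).toTemperedDistribution < ∞ := by
  have h : ∀ x ω : V, ‖stft g (volume : Measure V).toTemperedDistribution x ω‖ₑ =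
      ‖(𝓕⁻ g : 𝓢(V, ℂ)) ω‖ₑ := by
    intro x ω
    rw [stft_volume, ← ofReal_norm, RCLike.norm_conj, norm_mul, norm_modChar, one_mul,
      ofReal_norm, SchwartzMap.fourierInv_coe]
  refine lt_of_le_of_lt ?_ ((𝓕⁻ g : 𝓢(V, ℂ)).memLp 1 volume).eLpNorm_lt_top
  refine eLpNorm_mono_enorm fun ω => ?_
  rw [enorm_eq_self, eLpNorm_exponent_top]
  refine essSup_le_of_ae_le _ (Filter.Eventually.of_forall fun x => ?_)
  exact (h x ω).le

theorem isSjostrandSymbol_one (G : 𝓢(WithLp 2 (V × V), ℂ)) : IsSjostrandSymbol G fun _ => 1 := by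
  refine ⟨continuous_const, _, modNorm_volume_lt_top G, fun φ => ?_⟩
  simp only [mul_one]
  exact ⟨φ.integrable, Measure.toTemperedDistribution_apply _ φ⟩

end ConstantSymbol

/-! ### The quadratic phase and its Hessians. -/

section QuadraticPhase

variable {E : Type*} [NormedAddCommGroup E] [NormedSpace ℝ E]

/-- A derivative linear in the base point has constant derivative `B`, and all higher derivatives
vanish. -/
theorem exists_norm_iteratedFDeriv_le_of_hasFDerivAt {Φ : E → ℝ} {B : E →L[ℝ] E →L[ℝ] ℝ}
    (hB : ∀ z, HasFDerivAt Φ (B z) z) {n : ℕ} (hn : 2 ≤ n) :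
    ∃ C : ℝ, ∀ z, ‖iteratedFDeriv ℝ n Φ z‖ ≤ C := by
  obtain ⟨m, rfl⟩ := Nat.exists_eq_add_of_le' hn
  have h1 : fderiv ℝ Φ = B := funext fun z => (hB z).fderiv
  have h2 : fderiv ℝ (B : E → E →L[ℝ] ℝ) = fun _ => B := funext fun z => B.fderiv
  have h3 : ∀ z, ‖iteratedFDeriv ℝ (m + 2) Φ z‖ =
      ‖iteratedFDeriv ℝ m (fun _ : E => B) z‖ := fun z => by
    rw [← norm_iteratedFDeriv_fderiv, h1, ← norm_iteratedFDeriv_fderiv, h2]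
  simp only [h3]
  rcases eq_or_ne m 0 with rfl | hm
  · exact ⟨‖B‖, fun z => by rw [norm_iteratedFDeriv_zero]⟩
  · exact ⟨0, fun z => by rw [iteratedFDeriv_const_of_ne hm]; simp⟩

theorem iteratedFDeriv_two_of_hasFDerivAt {Φ : E → ℝ} {B : E →L[ℝ] E →L[ℝ] ℝ}
    (hB : ∀ z, HasFDerivAt Φ (B z) z) (z v w : E) :
    iteratedFDeriv ℝ 2 Φ z ![v, w] = B v w := by
  have h1 : fderiv ℝ Φ = B := funext fun z => (hB z).fderiv
  rw [iteratedFDeriv_two_apply, h1, B.fderiv]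
  rfl

variable {d : ℕ}

/-- The Hessian of the phase `x·η + |η|²/2`, as a bilinear form. -/
noncomputable def schrodingerHessian :
    WithLp 2 (EuclideanSpace ℝ (Fin d) × EuclideanSpace ℝ (Fin d)) →L[ℝ]
      WithLp 2 (EuclideanSpace ℝ (Fin d) × EuclideanSpace ℝ (Fin d)) →L[ℝ] ℝ :=
  let π₁ := WithLp.fstL 2 ℝ (EuclideanSpace ℝ (Fin d)) (EuclideanSpace ℝ (Fin d))
  let π₂ := WithLp.sndL 2 ℝ (EuclideanSpace ℝ (Fin d)) (EuclideanSpace ℝ (Fin d))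
  (innerSL ℝ).bilinearComp π₁ π₂ + (innerSL ℝ).bilinearComp π₂ π₁ +
    (innerSL ℝ).bilinearComp π₂ π₂

theorem schrodingerHessian_apply
    (z w : WithLp 2 (EuclideanSpace ℝ (Fin d) × EuclideanSpace ℝ (Fin d))) :
    schrodingerHessian z w = ⟪z.fst, w.snd⟫ + ⟪z.snd, w.fst⟫ + ⟪z.snd, w.snd⟫ := rfl

theorem hasFDerivAt_schrodingerPhase
    (z : WithLp 2 (EuclideanSpace ℝ (Fin d) × EuclideanSpace ℝ (Fin d))) :
    HasFDerivAt schrodingerPhase (schrodingerHessian z) z := by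
  have h₁ := (WithLp.fstL 2 ℝ (EuclideanSpace ℝ (Fin d))
    (EuclideanSpace ℝ (Fin d))).hasFDerivAt (x := z)
  have h₂ := (WithLp.sndL 2 ℝ (EuclideanSpace ℝ (Fin d))
    (EuclideanSpace ℝ (Fin d))).hasFDerivAt (x := z)
  have h := (h₁.inner ℝ h₂).add (h₂.norm_sq.mul_const (2 : ℝ)⁻¹)
  refine h.congr_fderiv ?_
  ext w
  simp [schrodingerHessian_apply, real_inner_comm]

theorem mixedHessian_schrodingerPhase
    (z : WithLp 2 (EuclideanSpace ℝ (Fin d) × EuclideanSpace ℝ (Fin d))) :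
    mixedHessian schrodingerPhase z = 1 := by
  ext i l
  simp [mixedHessian, iteratedFDeriv_two_of_hasFDerivAt hasFDerivAt_schrodingerPhase,
    schrodingerHessian_apply, basisX, basisEta, Matrix.one_apply, EuclideanSpace.inner_single_left, eq_comm]

theorem etaHessian_schrodingerPhase
    (z : WithLp 2 (EuclideanSpace ℝ (Fin d) × EuclideanSpace ℝ (Fin d))) :
    etaHessian schrodingerPhase z = 1 := by
  ext i l
  simp [etaHessian, iteratedFDeriv_two_of_hasFDerivAt hasFDerivAt_schrodingerPhase,
    schrodingerHessian_apply, basisEta, Matrix.one_apply, EuclideanSpace.inner_single_left]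

theorem isTamePhase_schrodingerPhase : IsTamePhase (schrodingerPhase (d := d)) where
  smooth := by
    have h₁ := (WithLp.fstL 2 ℝ (EuclideanSpace ℝ (Fin d)) (EuclideanSpace ℝ (Fin d))).contDiff
      (n := ((⊤ : ℕ∞) : WithTop ℕ∞))
    have h₂ := (WithLp.sndL 2 ℝ (EuclideanSpace ℝ (Fin d)) (EuclideanSpace ℝ (Fin d))).contDiff
      (n := ((⊤ : ℕ∞) : WithTop ℕ∞))
    exact (h₁.inner ℝ h₂).add ((h₂.norm_sq ℝ).div_const 2)
  bounded_deriv n hn :=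
    exists_norm_iteratedFDeriv_le_of_hasFDerivAt hasFDerivAt_schrodingerPhase hn
  nondegenerate := ⟨1, one_pos, fun z => by simp [mixedHessian_schrodingerPhase]⟩

theorem isEtaNondegenerate_schrodingerPhase : IsEtaNondegenerate (schrodingerPhase (d := d)) :=
  ⟨1, one_pos, fun z => by simp [etaHessian_schrodingerPhase]⟩

theorem fourierIntegralOperator_schrodingerPhase (f : 𝓢(EuclideanSpace ℝ (Fin d), ℂ)) :
    fourierIntegralOperator schrodingerPhase (fun _ => 1) f = schrodingerMultiplier f := by
  funext x
  refine integral_congr_ae (Filter.Eventually.of_forall fun η => ?_)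
  simp only [schrodingerPhase, mul_one, WithLp.toLp_fst, WithLp.toLp_snd]
  rw [← Complex.exp_add]
  congr 2
  push_cast
  ring

end QuadraticPhase

/-! ### The proposition. -/

theorem mainTheorem10 (d : ℕ) (hd : 1 ≤ d)
    (g : 𝓢(EuclideanSpace ℝ (Fin d), ℂ)) (hg : g ≠ 0)
    (G : 𝓢(WithLp 2 (EuclideanSpace ℝ (Fin d) × EuclideanSpace ℝ (Fin d)), ℂ)) (hG : G ≠ 0) :
    (∀ r₁ r₂ t₁ t₂ : ℝ≥0∞, 1 ≤ r₁ → 1 ≤ r₂ → 1 ≤ t₁ → 1 ≤ t₂ →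
      (IsBoundedOnMod g r₁ r₂ t₁ t₂ schrodingerMultiplier ↔ r₁ ≤ t₁ ∧ r₂ ≤ t₂)) ∧
    (IsTamePhase (schrodingerPhase (d := d)) ∧ IsEtaNondegenerate (schrodingerPhase (d := d)) ∧
      IsSjostrandSymbol G (fun _ => 1) ∧
      ∀ f : 𝓢(EuclideanSpace ℝ (Fin d), ℂ),
        fourierIntegralOperator schrodingerPhase (fun _ => 1) f = schrodingerMultiplier f) ∧
    (∀ r₁ r₂ : ℝ≥0∞, 1 ≤ r₁ → r₁ < r₂ →
      ¬ ∀ (Φ : WithLp 2 (EuclideanSpace ℝ (Fin d) × EuclideanSpace ℝ (Fin d)) → ℝ)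
          (σ : WithLp 2 (EuclideanSpace ℝ (Fin d) × EuclideanSpace ℝ (Fin d)) → ℂ),
          IsTamePhase Φ → IsEtaNondegenerate Φ → IsSjostrandSymbol G σ →
            IsBoundedOnMod g r₁ r₂ r₂ r₁ (fourierIntegralOperator Φ σ)) := by
  have : NeZero d := ⟨by omega⟩
  have hnt : Nontrivial (EuclideanSpace ℝ (Fin d)) := inferInstance
  refine ⟨fun r₁ r₂ t₁ t₂ hr₁ hr₂ ht₁ ht₂ => ⟨fun hT => hT.le_and_le hg hr₁ hr₂ ht₁ ht₂,
    fun h => isBoundedOnMod_schrodingerMultiplier hg hr₁ hr₂ h.1 h.2⟩,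
    ⟨isTamePhase_schrodingerPhase, isEtaNondegenerate_schrodingerPhase, isSjostrandSymbol_one G,
      fourierIntegralOperator_schrodingerPhase⟩, fun r₁ r₂ hr₁ hr h => ?_⟩
  have hT := h _ _ isTamePhase_schrodingerPhase isEtaNondegenerate_schrodingerPhase
    (isSjostrandSymbol_one G)
  rw [funext fourierIntegralOperator_schrodingerPhase] at hT
  -- With target exponents `(r₂, r₁)`, the second necessary condition reads `r₂ ≤ r₁`.
  exact hr.not_ge (hT.le_and_le hg hr₁ (hr₁.trans hr.le) (hr₁.trans hr.le) hr₁).2
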